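/- Let $D=\{z\in\mathbb C:|z|<1\}$, $S^1=\{z\in\mathbb C:|z|=1\}$, and let $P,Q,R\in D$ be the vertices of a nondegenerate triangle. For $v\in S^1$ let $\psi(v)\in S^1$ be the first point $w$, counterclockwise from $v$, such that the chord $vw$ is tangent to the filled triangle $PQR$ (it meets the triangle but not its interior). Let $\rho(\psi)=\lim_n F^n(0)/n$ be the rotation number of the circle homeomorphism $\psi$, where $F:\mathbb R\to\mathbb R$ is the continuous lift of $\psi$ with respect to $x\mapsto e^{2\pi i x}$ with $F(0)\in(0,1)$. Let $G^{-1}(z)=z/(1+\sqrt{1-|z|^2})$, let $$d(A,B)=\operatorname{arccosh}\Bigl(1+\tfrac{2|A-B|^2}{(1-|A|^2)(1-|B|^2)}\Bigr),\qquad d'(A,B)=d(G^{-1}A,G^{-1}B)\qquad(A,B\in D)$$ (so $d'$ is the hyperbolic distance of the Beltrami–Klein disk), and put $$\Delta'=\log\frac{e^{d'(P,Q)}+1}{e^{d'(P,Q)}-1},\qquad \delta=\min\{d'(R,S): S\in D \text{ on the line } PQ\}.$$ For $u,v\in S^1$ let $\mathrm{arc}(uv)$ be the closed arc of $S^1$ running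 counterclockwise from $u$ to $v$. Suppose $\rho(\psi)=1/3$. (1) Suppose $\delta=\Delta'$. Then there is $u_1\in S^1$ with $\psi^3(u_1)=u_1$. For any such $u_1$, with $u_2=\psi(u_1)$ and $u_3=\psi^2(u_1)$, the points $u_1,u_2,u_3$ are distinct and are the only solutions of $\psi^3(z)=z$. Put $I_1=\mathrm{arc}(u_3u_1)\setminus\{u_3\}$ and $I_j=\mathrm{arc}(u_{j-1}u_j)\setminus\{u_{j-1}\}$ for $j=2,3$. Then for $j=1,2,3$ and every $z\in I_j$, $\psi^{3n}(z)\to u_j$ as $n\to\infty$. (2) Suppose $\delta>\Delta'$. Then there is $u_1\in S^1$ with $\psi^3(u_1)=u_1$ such that $\psi^{3n}(w)\to u_1$ for some $w\in S^1\setminus\{u_1,\psi(u_1),\psi^2(u_1)\}$. For any such $u_1$, put $u_2=\psi(u_1)$ and $u_3=\psi^2(u_1)$; then there is $v_1\in\mathrm{arc}(u_1u_2)\setminus\{u_1,u_2\}$ with $\psi^3(v_1)=v_1$. For any such $v_1$, put $v_2=\psi(v_1)$ and $v_3=\psi^2(v_1)$; then $u_1,u_2,u_3,v_1,v_2,v_3$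 are distinct and are the only solutions of $\psi^3(z)=z$. Put $I_1'=\mathrm{arc}(v_3v_1)\setminus\{v_3,v_1\}$ and $I_j'=\mathrm{arc}(v_{j-1}v_j)\setminus\{v_{j-1},v_j\}$ for $j=2,3$. Then for $j=1,2,3$ and every $z\in I_j'$, $\psi^{3n}(z)\to u_j$ as $n\to\infty$. In both cases $\psi$ is not topologically conjugate to a rotation of $S^1$. -/

import Mathlib

open Filter Topology

noncomputable section

namespace KleinTriangle

/-- Hyperbolic distance of the Poincare disk `{z : ℂ | ‖z‖ < 1}`. -/
def poincareDist (P Q : ℂ) : ℝ :=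
  Real.arcosh (1 + 2 * ‖P - Q‖ ^ 2 / ((1 - ‖P‖ ^ 2) * (1 - ‖Q‖ ^ 2)))

/-- `Δ(P, Q) = log ((e ^ d(P,Q) + 1) / (e ^ d(P,Q) - 1))` on the Poincare disk. -/
def poincareDelta (P Q : ℂ) : ℝ :=
  Real.log ((Real.exp (poincareDist P Q) + 1) / (Real.exp (poincareDist P Q) - 1))

/-- The isometry from the Beltrami-Klein disk to the Poincare disk,
`z ↦ z / (1 + √(1 - |z|²))`. -/
def kleinToPoincare (z : ℂ) : ℂ :=
  z / ((1 + Real.sqrt (1 - ‖z‖ ^ 2) : ℝ) : ℂ)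

/-- Hyperbolic distance `d'` of the Beltrami-Klein disk. -/
def kleinDist (P Q : ℂ) : ℝ :=
  poincareDist (kleinToPoincare P) (kleinToPoincare Q)

/-- `Δ'(P, Q)` on the Beltrami-Klein disk. -/
def kleinDelta (P Q : ℂ) : ℝ :=
  poincareDelta (kleinToPoincare P) (kleinToPoincare Q)

/-- `δ(P, Q, R)`: the hyperbolic distance from `R` to the hyperbolic line `PQ`, which in the
Beltrami-Klein model is the part of the Euclidean line `PQ` inside the open unit disk. -/
def distToLine (P Q R : ℂ) : ℝ :=
  sInf (kleinDist R '' {S : ℂ | S ∈ line[ℝ, P, Q] ∧ ‖S‖ < 1})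

/-- `P, Q, R` are the vertices of a nondegenerate triangle in the open unit disk. -/
def IsTriangleInDisk (P Q R : ℂ) : Prop :=
  AffineIndependent ℝ ![P, Q, R] ∧ ‖P‖ < 1 ∧ ‖Q‖ < 1 ∧ ‖R‖ < 1

/-- The closed (filled) triangle with vertices `P, Q, R`. -/
def triangle (P Q R : ℂ) : Set ℂ := convexHull ℝ {P, Q, R}

/-- The closed arc of the unit circle that runs counterclockwise from `u` to `v`
(the single point `u` if `u = v`). -/
def arc (u v : Circle) : Set Circle :=
  {z | ∃ s t : ℝ, 0 ≤ s ∧ s ≤ t ∧ t < 2 * Real.pi ∧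
    z = u * Circle.exp s ∧ v = u * Circle.exp t}

/-- The chord `vw` is tangent to the triangle: it meets the triangle, but not its interior. -/
def IsTangentChord (P Q R : ℂ) (v w : Circle) : Prop :=
  (segment ℝ (v : ℂ) (w : ℂ) ∩ triangle P Q R).Nonempty ∧
    Disjoint (segment ℝ (v : ℂ) (w : ℂ)) (interior (triangle P Q R))

/-- `w` is the first endpoint, counterclockwise from `v`, of a tangent chord from `v`. -/
def IsFirstTangent (P Q R : ℂ) (v w : Circle) : Prop :=
  IsTangentChord P Q R v w ∧ ∀ w', IsTangentChord P Q R v w' → w ∈ arc v w'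

/-- A point of the open unit disk lies on a chord through `1`. -/
theorem exists_chord (Y : ℂ) (hY : ‖Y‖ < 1) :
    ∃ t r : ℝ, 0 < t ∧ t < 2 * Real.pi ∧ 0 < r ∧ r < 1 ∧
      Y = 1 + r * ((Circle.exp t : ℂ) - 1) := by
  have hsq : Y.re ^ 2 + Y.im ^ 2 < 1 := by
    have h1 := Complex.sq_norm Y
    rw [Complex.normSq_apply] at h1
    nlinarith [norm_nonneg Y]
  have hre : 0 < 1 - Y.re := by nlinarith [sq_nonneg Y.im, sq_nonneg (Y.re - 1)]
  obtain ⟨r, hr⟩ : ∃ r : ℝ, r = ((1 - Y.re) ^ 2 + Y.im ^ 2) / (2 * (1 - Y.re)) := ⟨_, rfl⟩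
  have hmul : r * (2 * (1 - Y.re)) = (1 - Y.re) ^ 2 + Y.im ^ 2 := by
    rw [hr]; field_simp
  have hr0 : 0 < r := by rw [hr]; positivity
  have hr1 : r < 1 := by
    rw [hr, div_lt_one (by positivity)]; nlinarith
  have hrc : (r : ℂ) ≠ 0 := by exact_mod_cast hr0.ne'
  have hnorm : ‖(1 + (Y - 1) / (r : ℂ) : ℂ)‖ = 1 := by
    have h2 : ‖(1 + (Y - 1) / (r : ℂ) : ℂ)‖ ^ 2 = 1 := by
      rw [Complex.sq_norm, Complex.normSq_apply]
      simp only [Complex.add_re, Complex.add_im, Complex.one_re, Complex.one_im,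
        Complex.div_ofReal_re, Complex.div_ofReal_im, Complex.sub_re, Complex.sub_im]
      field_simp
      nlinarith
    nlinarith [norm_nonneg (1 + (Y - 1) / (r : ℂ) : ℂ)]
  obtain ⟨t, ht, hte⟩ : ∃ t ∈ Set.Ico 0 (2 * Real.pi),
      ((Circle.exp t : Circle) : ℂ) = 1 + (Y - 1) / (r : ℂ) := by
    obtain ⟨a, ha⟩ := Circle.exp_surjective
      (⟨1 + (Y - 1) / (r : ℂ), by simpa [Submonoid.unitSphere] using hnorm⟩ : Circle)
    refine ⟨toIcoMod Real.two_pi_pos 0 a, by simpa using toIcoMod_mem_Ico Real.two_pi_pos 0 a, ?_⟩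
    rw [← toIcoMod_add_toIcoDiv_zsmul Real.two_pi_pos 0 a, zsmul_eq_mul, Circle.exp_add,
      Circle.exp_int_mul_two_pi, mul_one] at ha
    rw [ha]
  have hE : Y = 1 + r * ((Circle.exp t : ℂ) - 1) := by
    rw [hte]; field_simp; ring
  refine ⟨t, r, lt_of_le_of_ne ht.1 ?_, ht.2, hr0, hr1, hE⟩
  rintro rfl
  rw [Circle.exp_zero] at hE
  simp only [Circle.coe_one, sub_self, mul_zero, add_zero] at hE
  rw [hE] at hre
  simp at hre

/-- On which side of a chord from `v` another chord from `v` runs. -/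
theorem side_eq (v : Circle) (t τ r : ℝ) :
    ((starRingEnd ℂ) ((v : ℂ) * (Circle.exp t : ℂ) - v) *
      ((v : ℂ) * (1 + r * ((Circle.exp τ : ℂ) - 1)) - v)).im =
      r * (4 * Real.sin (t / 2) * Real.sin (τ / 2) * Real.sin ((τ - t) / 2)) := by
  have hv : (starRingEnd ℂ) (v : ℂ) * (v : ℂ) = 1 := by
    rw [← Complex.normSq_eq_conj_mul_self, Circle.normSq_coe]; simp
  have h1 : (starRingEnd ℂ) ((v : ℂ) * (Circle.exp t : ℂ) - v) *
      ((v : ℂ) * (1 + r * ((Circle.exp τ : ℂ) - 1)) - v) =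
      r * ((starRingEnd ℂ) ((Circle.exp t : ℂ) - 1) * ((Circle.exp τ : ℂ) - 1)) := by
    simp only [map_sub, map_mul, map_one]
    linear_combination (r * ((starRingEnd ℂ) (Circle.exp t : ℂ) - 1) *
      ((Circle.exp τ : ℂ) - 1)) * hv
  have hE : ∀ x : ℝ, (Circle.exp x : ℂ) = (Real.cos x : ℂ) + Real.sin x * Complex.I := by
    intro x; rw [Circle.coe_exp, Complex.exp_mul_I]; push_cast; rfl
  have h2 : ((starRingEnd ℂ) ((Circle.exp t : ℂ) - 1) * ((Circle.exp τ : ℂ) - 1)).im =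
      (Real.cos t - 1) * Real.sin τ - Real.sin t * (Real.cos τ - 1) := by
    rw [hE, hE]
    simp only [map_sub, map_add, map_mul, map_one, Complex.conj_ofReal, Complex.conj_I,
      Complex.mul_im, Complex.sub_re, Complex.sub_im, Complex.add_re, Complex.add_im,
      Complex.mul_re, Complex.ofReal_re, Complex.ofReal_im, Complex.I_re, Complex.I_im,
      Complex.one_re, Complex.one_im, Complex.neg_re, Complex.neg_im]
    ring
  rw [h1, Complex.im_ofReal_mul, h2]
  have ht : t = 2 * (t / 2) := by ring
  have hτ : τ = 2 * (τ / 2) := by ring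
  have hd : (τ - t) / 2 = τ / 2 - t / 2 := by ring
  rw [hd]
  generalize t / 2 = a at *
  generalize τ / 2 = b at *
  subst ht hτ
  rw [Real.sin_sub, Real.sin_two_mul, Real.sin_two_mul, Real.cos_two_mul, Real.cos_two_mul]
  have ha := Real.sin_sq_add_cos_sq a
  have hb := Real.sin_sq_add_cos_sq b
  linear_combination (4 * r * Real.sin b * Real.cos b) * ha -
    (4 * r * Real.sin a * Real.cos a) * hb

/-- Every point of the circle has a unique first tangent endpoint, so `psi` below is
well defined. -/
theorem existsUnique_isFirstTangent {P Q R : ℂ} (hT : IsTriangleInDisk P Q R) (v : Circle) :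
    ∃! w, IsFirstTangent P Q R v w := by
  obtain ⟨-, hP, hQ, hR⟩ := hT
  have hpi := Real.pi_pos
  have hv : (v : ℂ) * (starRingEnd ℂ) (v : ℂ) = 1 := by
    rw [Complex.mul_conj, Circle.normSq_coe]; simp
  -- every vertex lies on a chord from `v`
  have key : ∀ X ∈ ({P, Q, R} : Set ℂ), ∃ t r : ℝ, 0 < t ∧ t < 2 * Real.pi ∧ 0 < r ∧ r < 1 ∧
      X = v * (1 + r * ((Circle.exp t : ℂ) - 1)) := by
    intro X hX
    have hX1 : ‖X‖ < 1 := by rcases hX with rfl | rfl | rfl <;> assumption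
    obtain ⟨t, r, h1, h2, h3, h4, h5⟩ := exists_chord ((starRingEnd ℂ) (v : ℂ) * X)
      (by rw [norm_mul, RCLike.norm_conj, Circle.norm_coe, one_mul]; exact hX1)
    refine ⟨t, r, h1, h2, h3, h4, ?_⟩
    rw [← h5, ← mul_assoc, hv, one_mul]
  choose! T r hT0 hT2 hr0 hr1 hX using key
  -- the vertex seen first
  obtain ⟨A, hA, hmin⟩ : ∃ A ∈ ({P, Q, R} : Set ℂ), ∀ X ∈ ({P, Q, R} : Set ℂ), T A ≤ T X :=
    Set.exists_min_image _ T (by simp) ⟨P, by simp⟩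
  have hlin : ∀ c : ℂ, IsLinearMap ℝ (fun X : ℂ => (c * X).im) := fun c =>
    ⟨fun x y => by simp [mul_add], fun a x => by simp; ring⟩
  have side : ∀ (t : ℝ) (X : ℂ), X ∈ ({P, Q, R} : Set ℂ) →
      ((starRingEnd ℂ) ((v : ℂ) * (Circle.exp t : ℂ) - v) * X).im =
      ((starRingEnd ℂ) ((v : ℂ) * (Circle.exp t : ℂ) - v) * v).im +
      r X * (4 * Real.sin (t / 2) * Real.sin (T X / 2) * Real.sin ((T X - t) / 2)) := by
    intro t X hXm
    rw [← side_eq v t (T X) (r X), ← hX X hXm, mul_sub, Complex.sub_im]; ring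
  -- points on a chord from `v`
  have seg : ∀ (t : ℝ) (z : ℂ), z ∈ segment ℝ (v : ℂ) ((v * Circle.exp t : Circle) : ℂ) →
      ((starRingEnd ℂ) ((v : ℂ) * (Circle.exp t : ℂ) - v) * z).im =
      ((starRingEnd ℂ) ((v : ℂ) * (Circle.exp t : ℂ) - v) * v).im := by
    rintro t z hz
    rw [segment_eq_image'] at hz
    obtain ⟨a, -, rfl⟩ := hz
    rw [mul_add, Complex.add_im, Circle.coe_mul, Complex.real_smul, mul_left_comm,
      ← Complex.normSq_eq_conj_mul_self, ← Complex.ofReal_mul, Complex.ofReal_im, add_zero]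
  have hsinpos : ∀ t : ℝ, 0 < t → t < 2 * Real.pi → 0 < Real.sin (t / 2) := fun t h1 h2 =>
    Real.sin_pos_of_pos_of_lt_pi (by linarith) (by linarith)
  have hA0 := hT0 A hA
  have hA2 := hT2 A hA
  have tang : IsTangentChord P Q R v (v * Circle.exp (T A)) := by
    constructor
    · refine ⟨A, ?_, subset_convexHull ℝ _ hA⟩
      rw [segment_eq_image']
      refine ⟨r A, ⟨(hr0 A hA).le, (hr1 A hA).le⟩, ?_⟩
      conv_rhs => rw [hX A hA]
      simp only [Circle.coe_mul, Complex.real_smul]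
      ring
    · rw [Set.disjoint_left]
      intro z hz hzi
      have hsub : triangle P Q R ⊆ {X : ℂ |
          ((starRingEnd ℂ) ((v : ℂ) * (Circle.exp (T A) : ℂ) - v) * v).im ≤
          ((starRingEnd ℂ) ((v : ℂ) * (Circle.exp (T A) : ℂ) - v) * X).im} := by
        refine convexHull_min ?_ (convex_halfSpace_ge (hlin _) _)
        intro X hXm
        have h1 : 0 ≤ Real.sin ((T X - T A) / 2) :=
          Real.sin_nonneg_of_nonneg_of_le_pi (by linarith [hmin X hXm])
            (by linarith [hT2 X hXm])
        have h2 := hsinpos _ hA0 hA2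
        have h3 := hsinpos _ (hT0 X hXm) (hT2 X hXm)
        have h4 := hr0 X hXm
        rw [Set.mem_ofPred_eq, side _ _ hXm]
        have : 0 ≤ r X * (4 * Real.sin (T A / 2) * Real.sin (T X / 2) *
          Real.sin ((T X - T A) / 2)) := by positivity
        linarith
      -- move from `z` to the other side of the chord
      set c : ℂ := (v : ℂ) * (Circle.exp (T A) : ℂ) - v with hc
      have hc0 : c ≠ 0 := by
        intro h0
        have h1 := side_eq v (T A) Real.pi 1
        rw [← hc, h0] at h1
        have h2 := hsinpos _ hA0 hA2
        by_cases hAp : T A = Real.pi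
        · rw [hc, hAp, Circle.coe_exp, Complex.exp_pi_mul_I] at h0
          have : (v : ℂ) = 0 := by linear_combination (-1 / 2 : ℂ) * h0
          exact Circle.coe_ne_zero v this
        · have h3 : Real.sin ((Real.pi - T A) / 2) ≠ 0 := by
            rcases lt_or_gt_of_ne hAp with h | h
            · exact (Real.sin_pos_of_pos_of_lt_pi (by linarith) (by linarith)).ne'
            · exact (Real.sin_neg_of_neg_of_neg_pi_lt (by linarith) (by linarith)).ne
          simp [h2.ne', h3] at h1
      have htend : Tendsto (fun ε : ℝ => z - (ε : ℂ) * (Complex.I * c)) (𝓝[>] 0) (𝓝 z) := by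
        have : Continuous (fun ε : ℝ => z - (ε : ℂ) * (Complex.I * c)) := by fun_prop
        have h := this.tendsto 0
        simp only [Complex.ofReal_zero, zero_mul, sub_zero] at h
        exact h.mono_left nhdsWithin_le_nhds
      obtain ⟨ε, hε, hε0⟩ := ((htend.eventually (mem_interior_iff_mem_nhds.1 hzi)).and
        self_mem_nhdsWithin).exists
      have h1 := hsub hε
      have h2 := seg _ _ hz
      rw [← hc] at h2
      have h3 : (starRingEnd ℂ) c * (z - (ε : ℂ) * (Complex.I * c)) =
          (starRingEnd ℂ) c * z - ((ε * Complex.normSq c : ℝ) : ℂ) * Complex.I := by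
        rw [Complex.ofReal_mul, Complex.normSq_eq_conj_mul_self]; ring
      rw [Set.mem_ofPred_eq, h3, Complex.sub_im, h2, Complex.im_ofReal_mul, Complex.I_im, mul_one] at h1
      have h4 := Complex.normSq_pos.2 hc0
      have h5 : 0 < ε * Complex.normSq c := mul_pos hε0 h4
      linarith
  have first : IsFirstTangent P Q R v (v * Circle.exp (T A)) := by
    refine ⟨tang, fun w' hw' => ?_⟩
    obtain ⟨a, ha⟩ := Circle.exp_surjective (v⁻¹ * w')
    obtain ⟨s, hs0, hs2, hs⟩ : ∃ s, 0 ≤ s ∧ s < 2 * Real.pi ∧ w' = v * Circle.exp s := by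
      have hm := toIcoMod_mem_Ico Real.two_pi_pos 0 a
      refine ⟨toIcoMod Real.two_pi_pos 0 a, hm.1, by simpa using hm.2, ?_⟩
      rw [← toIcoMod_add_toIcoDiv_zsmul Real.two_pi_pos 0 a, zsmul_eq_mul, Circle.exp_add,
        Circle.exp_int_mul_two_pi, mul_one] at ha
      rw [ha, mul_inv_cancel_left]
    refine ⟨T A, s, hA0.le, ?_, hs2, rfl, hs⟩
    by_contra! hlt
    obtain ⟨⟨z, hz, hzT⟩, -⟩ := hw'
    rw [hs] at hz
    rcases hs0.eq_or_lt with h0 | h0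
    · -- the degenerate chord does not meet the triangle
      rw [← h0, Circle.exp_zero, mul_one, segment_same] at hz
      have hball : triangle P Q R ⊆ Metric.ball (0 : ℂ) 1 := by
        refine convexHull_min ?_ (convex_ball _ _)
        rintro X (rfl | rfl | rfl) <;> simpa
      have := hball hzT
      rw [Set.mem_singleton_iff.1 hz] at this
      rw [mem_ball_zero_iff, Circle.norm_coe] at this
      exact lt_irrefl _ this
    · have hsub : triangle P Q R ⊆ {X : ℂ |
          ((starRingEnd ℂ) ((v : ℂ) * (Circle.exp s : ℂ) - v) * v).im <
          ((starRingEnd ℂ) ((v : ℂ) * (Circle.exp s : ℂ) - v) * X).im} := by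
        refine convexHull_min ?_ (convex_halfSpace_gt (hlin _) _)
        intro X hXm
        have h1 : 0 < Real.sin ((T X - s) / 2) :=
          Real.sin_pos_of_pos_of_lt_pi (by linarith [hmin X hXm])
            (by linarith [hT2 X hXm])
        have h2 := hsinpos _ h0 hs2
        have h3 := hsinpos _ (hT0 X hXm) (hT2 X hXm)
        have h4 := hr0 X hXm
        rw [Set.mem_ofPred_eq, side _ _ hXm]
        have : 0 < r X * (4 * Real.sin (s / 2) * Real.sin (T X / 2) *
          Real.sin ((T X - s) / 2)) := by positivity
        linarith
      have h1 := hsub hzT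
      rw [Set.mem_ofPred_eq, seg _ _ hz] at h1
      exact lt_irrefl _ h1
  refine ⟨_, first, fun w hw => ?_⟩
  obtain ⟨s, t, hs, hst, ht, h1, h2⟩ := hw.2 _ tang
  obtain ⟨s', t', hs', hst', ht', h1', h2'⟩ := first.2 _ hw.1
  have inj : ∀ a b : ℝ, 0 ≤ a → a < 2 * Real.pi → 0 ≤ b → b < 2 * Real.pi →
      v * Circle.exp a = v * Circle.exp b → a = b := by
    intro a b ha ha' hb hb' hab
    exact Circle.exp_injOn_Ico (a := 0) (b := 2 * Real.pi) (by linarith) ⟨ha, ha'⟩ ⟨hb, hb'⟩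
      (mul_left_cancel hab)
  have e1 : t = s' := inj _ _ (hs.trans hst) ht hs' (hst'.trans_lt ht') (h2.symm.trans h1')
  have e2 : s = t' := inj _ _ hs (hst.trans_lt ht) (hs'.trans hst') ht' (h1.symm.trans h2')
  have e3 : s = t := by linarith
  rw [h1, h2, e3]

/-- The circle map `ψ` of the triangle: `ψ v` is the first endpoint, counterclockwise from `v`,
of a tangent chord from `v`. -/
def psi (P Q R : ℂ) (v : Circle) : Circle :=
  Classical.epsilon (IsFirstTangent P Q R v)

theorem psi_spec {P Q R : ℂ} (hT : IsTriangleInDisk P Q R) (v : Circle) :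
    IsFirstTangent P Q R v (psi P Q R v) :=
  Classical.epsilon_spec (existsUnique_isFirstTangent hT v).exists

/-- `f : S¹ → S¹` has rotation number `ρ`, computed with a continuous lift `F : ℝ → ℝ`
(nondecreasing, `F (x + 1) = F x + 1`) normalized by `F 0 ∈ (0, 1)`; here `S¹` is parametrized
by `x ↦ exp (2 π i x)` and `translationNumber` is the limit of `F^[n] 0 / n`. -/
def HasRotationNumber (f : Circle → Circle) (ρ : ℝ) : Prop :=
  ∃ F : CircleDeg1Lift, Continuous F ∧
    (∀ x : ℝ, Circle.exp (2 * Real.pi * F x) = f (Circle.exp (2 * Real.pi * x))) ∧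
    F 0 ∈ Set.Ioo (0 : ℝ) 1 ∧ F.translationNumber = ρ

/-- `f` is topologically conjugate to a rotation of the circle. -/
def IsConjugateToRotation (f : Circle → Circle) : Prop :=
  ∃ (h : Circle ≃ₜ Circle) (a : Circle), ∀ v, h (f v) = a * h v

end KleinTriangle

end

open KleinTriangle

/-! A tangent chord passes through a vertex (`IsTangentChord.exists_onChord`), and the chord `vw`
through `X` is given by `v + w = X + X̄vw`, a Möbius involution in `v`. Since the rotation number is
1/3, the points with `ψ³ = id` are the images of the fixed points of `ret F`, which is `F³ - 1` for
the lift `F`. The three sides of such an orbit pass through the three different vertices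
(`exists_isCircumscribed`), so near the orbit `ψ³` is a product of three chord involutions.

This product has a matrix `(A B; B̄ Ā)` of determinant `D = (1 - |P|²)(1 - |Q|²)(1 - |R|²)` and
trace `2 Re A`, where `Re A` is twice the signed area of the triangle. It is thus parabolic or
hyperbolic according as `area² = D` or `area² > D`. On the circle it sends `v` to `v W / W̄` with `W
= A + B v̄` (`mul_conj_factor`), and `W` is real and positive at a periodic point, so nearby the
sign of `Im W` is the direction of motion. `IsCircumscribed.factor_form` writes `Im W` as `2 sin θ
(c sin θ - k cos θ)`, `θ = π(y - x)`, with `k² = area² - D`. If `k = 0`, then `c > 0` and points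
move forward on both sides; if `k ≠ 0`, the fixed point attracts or repels (`exists_local_form`).
The same formula has at most two zeros modulo a full turn. As the orientation of the triangle fixes
the cyclic order of the vertices, there is one orbit if `k = 0` and there are at most two otherwise
(`sameOrbit_of_eq`, `sameOrbit_of_lt`).

In the hyperbolic case the return map has opposite signs near the two ends of a gap between
consecutive orbit points, which forces a second orbit (`exists_fixed_in_gap`). Monotone iteration
then gives all limits. Finally `cosh² Δ'` and `cosh² δ` are rational in the Lorentzian products of
`P, Q, R`, and comparing them turns `δ ≥ Δ'` into `area² ≥ D` (`kleinDelta_le_distToLine_iff`). -/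

namespace KleinTriangle

/-! ### Iteration of monotone maps of the line -/

/-- A fixed point towards which nearby points move. -/
def IsAttracting (g : ℝ → ℝ) (x : ℝ) : Prop :=
  (∀ᶠ y in 𝓝[<] x, y < g y) ∧ ∀ᶠ y in 𝓝[>] x, g y < y

/-- A fixed point from which nearby points move away. -/
def IsRepelling (g : ℝ → ℝ) (x : ℝ) : Prop :=
  (∀ᶠ y in 𝓝[<] x, g y < y) ∧ ∀ᶠ y in 𝓝[>] x, y < g y

/-- The iterates increase and stay below `b`, so they converge; their limit is fixed by continuity,
and no point of `(a, b)` is fixed. -/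
theorem tendsto_iterate_right {g : ℝ → ℝ} (hg : Continuous g) (hm : Monotone g) {a b : ℝ}
    (hb : g b = b) (hlt : ∀ x ∈ Set.Ioo a b, x < g x) {x : ℝ} (hx : x ∈ Set.Ioc a b) :
    Tendsto (fun n => g^[n] x) atTop (𝓝 b) := by
  have hle : ∀ y ∈ Set.Ioc a b, y ≤ g y := by
    intro y hy
    rcases hy.2.eq_or_lt with h | h
    · rw [h, hb]
    · exact (hlt y ⟨hy.1, h⟩).le
  have hmem : ∀ n, g^[n] x ∈ Set.Ioc a b := by
    intro n
    induction n with
    | zero => exact hx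
    | succ n ih =>
      rw [Function.iterate_succ_apply']
      exact ⟨ih.1.trans_le (hle _ ih), (hm ih.2).trans_eq hb⟩
  have hmono : Monotone fun n => g^[n] x := by
    refine monotone_nat_of_le_succ fun n => ?_
    rw [Function.iterate_succ_apply']
    exact hle _ (hmem n)
  have hbdd : BddAbove (Set.range fun n => g^[n] x) :=
    ⟨b, by rintro _ ⟨n, rfl⟩; exact (hmem n).2⟩
  have hlim := tendsto_atTop_ciSup hmono hbdd
  have hfix := isFixedPt_of_tendsto_iterate hlim hg.continuousAt
  have h1 : x ≤ ⨆ n, g^[n] x := le_ciSup hbdd 0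
  have h2 : ⨆ n, g^[n] x ≤ b := ciSup_le fun n => (hmem n).2
  rcases h2.eq_or_lt with h | h
  · rwa [h] at hlim
  · exact absurd hfix (hlt _ ⟨hx.1.trans_le h1, h⟩).ne'

/-- Mirror image of `tendsto_iterate_right` under `y ↦ -y`. -/
theorem tendsto_iterate_left {g : ℝ → ℝ} (hg : Continuous g) (hm : Monotone g) {a b : ℝ}
    (ha : g a = a) (hlt : ∀ x ∈ Set.Ioo a b, g x < x) {x : ℝ} (hx : x ∈ Set.Ico a b) :
    Tendsto (fun n => g^[n] x) atTop (𝓝 a) := by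
  have key := tendsto_iterate_right (g := fun y => -g (-y)) (a := -b) (b := -a) (x := -x)
    (by fun_prop) (fun y z h => neg_le_neg (hm (neg_le_neg h))) (by simp [ha])
    (fun y hy => by
      have := hlt (-y) ⟨by linarith [hy.2], by linarith [hy.1]⟩
      linarith) ⟨by linarith [hx.2], by linarith [hx.1]⟩
  have hit : ∀ n, (fun y => -g (-y))^[n] (-x) = -g^[n] x := by
    intro n
    induction n with
    | zero => rfl
    | succ n ih => rw [Function.iterate_succ_apply', Function.iterate_succ_apply', ih, neg_neg]
  simp only [hit] at key
  simpa using key.neg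

/-- The order of `p` and `q` is left open: in the application they are chosen near the two ends of a
gap without control over which is smaller. -/
theorem exists_fixed_between {g : ℝ → ℝ} (hg : Continuous g) {p q : ℝ} (hp : p < g p)
    (hq : g q < q) : ∃ z ∈ Set.uIoo p q, g z = z := by
  have hne : p ≠ q := by rintro rfl; exact lt_asymm hp hq
  have h0 := intermediate_value_uIcc (a := p) (b := q) (f := fun x => g x - x) (by fun_prop)
  obtain ⟨z, hz, hz0⟩ := h0 (show (0 : ℝ) ∈ _ by
    rw [Set.mem_uIcc]; right; constructor <;> linarith)
  have hz1 : g z = z := by simpa [sub_eq_zero] using hz0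
  refine ⟨z, ?_, hz1⟩
  have h1 : z ≠ p := by rintro rfl; exact hp.ne' hz1
  have h2 : z ≠ q := by rintro rfl; exact hq.ne hz1
  rcases lt_or_gt_of_ne hne with h | h
  · rw [Set.uIcc_of_lt h] at hz
    rw [Set.uIoo_of_lt h]
    exact ⟨lt_of_le_of_ne hz.1 h1.symm, lt_of_le_of_ne hz.2 h2⟩
  · rw [Set.uIcc_of_gt h] at hz
    rw [Set.uIoo_of_gt h]
    exact ⟨lt_of_le_of_ne hz.1 h2.symm, lt_of_le_of_ne hz.2 h1⟩

theorem lt_map_of_no_fixed {g : ℝ → ℝ} (hg : Continuous g) {a b : ℝ}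
    (hno : ∀ z ∈ Set.Ioo a b, g z ≠ z) {c : ℝ} (hc : c ∈ Set.Ioo a b) (hcg : c < g c) :
    ∀ x ∈ Set.Ioo a b, x < g x := by
  intro x hx
  by_contra! h
  obtain ⟨z, hz, hz1⟩ := exists_fixed_between hg hcg (lt_of_le_of_ne h (hno x hx))
  refine hno z ⟨?_, ?_⟩ hz1
  · exact (lt_min hc.1 hx.1).trans hz.1
  · exact lt_of_lt_of_le hz.2 (max_lt hc.2 hx.2).le

theorem map_lt_of_no_fixed {g : ℝ → ℝ} (hg : Continuous g) {a b : ℝ}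
    (hno : ∀ z ∈ Set.Ioo a b, g z ≠ z) {c : ℝ} (hc : c ∈ Set.Ioo a b) (hcg : g c < c) :
    ∀ x ∈ Set.Ioo a b, g x < x := by
  intro x hx
  by_contra! h
  exact lt_asymm hcg
    (lt_map_of_no_fixed hg hno hx (lt_of_le_of_ne h (hno x hx).symm) c hc)

theorem exists_mem_Ioo_of_eventually_left {a b : ℝ} (hab : a < b) {p : ℝ → Prop}
    (h : ∀ᶠ y in 𝓝[<] b, p y) : ∃ c ∈ Set.Ioo a b, p c :=
  (Filter.Eventually.and (Ioo_mem_nhdsLT hab) h).exists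

theorem exists_mem_Ioo_of_eventually_right {a b : ℝ} (hab : a < b) {p : ℝ → Prop}
    (h : ∀ᶠ y in 𝓝[>] a, p y) : ∃ c ∈ Set.Ioo a b, p c :=
  (Filter.Eventually.and (Ioo_mem_nhdsGT hab) h).exists

/-! ### The third iterate of a lift, minus one turn -/

/-- The third iterate of a lift, minus one turn; its fixed points are the points of period three
and rotation number `1 / 3`. -/
def ret (F : CircleDeg1Lift) (x : ℝ) : ℝ := F (F (F x)) - 1

theorem ret_continuous {F : CircleDeg1Lift} (hF : Continuous F) : Continuous (ret F) := by
  unfold ret; fun_prop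

theorem ret_monotone (F : CircleDeg1Lift) : Monotone (ret F) := fun _ _ h =>
  sub_le_sub_right (F.monotone (F.monotone (F.monotone h))) 1

theorem ret_add_int (F : CircleDeg1Lift) (x : ℝ) (m : ℤ) : ret F (x + m) = ret F x + m := by
  simp only [ret, F.map_add_int]; ring

theorem map_sub_one' (F : CircleDeg1Lift) (x : ℝ) : F (x - 1) = F x - 1 := by
  have := F.map_sub_int x 1
  simpa using this

theorem ret_map (F : CircleDeg1Lift) (x : ℝ) : ret F (F x) = F (ret F x) := by
  rw [ret, ret, map_sub_one']

theorem ret_fixed_map {F : CircleDeg1Lift} {x : ℝ} (hx : ret F x = x) : ret F (F x) = F x := by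
  rw [ret_map, hx]

theorem map_map_map_of_fixed {F : CircleDeg1Lift} {x : ℝ} (hx : ret F x = x) :
    F (F (F x)) = x + 1 := by
  unfold ret at hx; linarith

/-- `y` is, up to an integer, in the orbit of the fixed point `x` of `ret F`. -/
def SameOrbit (F : CircleDeg1Lift) (x y : ℝ) : Prop :=
  ∃ m : ℤ, y = x + m ∨ y = F x + m ∨ y = F (F x) + m

/-- The map `y ↦ F (F y) - 1` carries a neighbourhood of `F x` to one of `x` and commutes with `ret
F`, so the inequalities pull back by monotonicity. `F` is not assumed injective; if `y` lands
exactly on `x`, then `ret F y = F x` and the claim is immediate. -/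
theorem IsAttracting.map {F : CircleDeg1Lift} (hF : Continuous F) {x : ℝ} (hx : ret F x = x)
    (h : IsAttracting (ret F) x) : IsAttracting (ret F) (F x) := by
  have h3 := map_map_map_of_fixed hx
  have hc : Tendsto (fun y => F (F y) - 1) (𝓝 (F x)) (𝓝 x) := by
    have : Continuous fun y => F (F y) - 1 := by fun_prop
    have h := this.tendsto (F x)
    rwa [h3, add_sub_cancel_right] at h
  have hcomm : ∀ y, ret F (F (F y) - 1) = F (F (ret F y)) - 1 := by
    intro y; rw [ret, ret, map_sub_one', map_sub_one', map_sub_one']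
  constructor
  · have h1 := hc.eventually (eventually_nhdsWithin_iff.1 h.1)
    filter_upwards [h1.filter_mono nhdsWithin_le_nhds, self_mem_nhdsWithin] with y hy hy1
    have hle : F (F y) - 1 ≤ x := by
      have := F.monotone (F.monotone (le_of_lt hy1)); linarith
    rcases hle.eq_or_lt with he | hlt
    · have : F (F y) = x + 1 := by linarith
      rw [ret, this, F.map_add_one, add_sub_cancel_right]
      exact hy1
    · have h4 := hy hlt
      rw [hcomm] at h4
      by_contra! h5
      have := F.monotone (F.monotone h5); linarith
  · have h1 := hc.eventually (eventually_nhdsWithin_iff.1 h.2)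
    filter_upwards [h1.filter_mono nhdsWithin_le_nhds, self_mem_nhdsWithin] with y hy hy1
    have hle : x ≤ F (F y) - 1 := by
      have := F.monotone (F.monotone (le_of_lt hy1)); linarith
    rcases hle.eq_or_lt with he | hlt
    · have : F (F y) = x + 1 := by linarith
      rw [ret, this, F.map_add_one, add_sub_cancel_right]
      exact hy1
    · have h4 := hy hlt
      rw [hcomm] at h4
      by_contra! h5
      have := F.monotone (F.monotone h5); linarith

theorem IsAttracting.not_isRepelling {g : ℝ → ℝ} {x : ℝ} (h : IsAttracting g x) :
    ¬ IsRepelling g x := by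
  intro h'
  obtain ⟨y, h1, h2⟩ := (h.1.and h'.1).exists
  exact lt_asymm h1 h2

theorem IsAttracting.sub_one {F : CircleDeg1Lift} {x : ℝ}
    (h : IsAttracting (ret F) (x + 1)) : IsAttracting (ret F) x := by
  have key : ∀ y, ret F (y + 1) = ret F y + 1 := fun y => by simpa using ret_add_int F y 1
  have ht : Tendsto (fun y : ℝ => y + 1) (𝓝 x) (𝓝 (x + 1)) :=
    (continuous_add_const 1).tendsto x
  constructor
  · have := ht.eventually (eventually_nhdsWithin_iff.1 h.1)
    filter_upwards [this.filter_mono nhdsWithin_le_nhds, self_mem_nhdsWithin] with y hy hy1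
    have := hy (Set.mem_Iio.2 (by linarith [Set.mem_Iio.1 hy1]))
    rw [key] at this; linarith
  · have := ht.eventually (eventually_nhdsWithin_iff.1 h.2)
    filter_upwards [this.filter_mono nhdsWithin_le_nhds, self_mem_nhdsWithin] with y hy hy1
    have := hy (Set.mem_Ioi.2 (by linarith [Set.mem_Ioi.1 hy1]))
    rw [key] at this; linarith

/-! ### Gaps between consecutive points of a period-three orbit -/

section orbits

variable {F : CircleDeg1Lift}

/-- The pull-back used for attraction fails for repulsion when `F ∘ F` collapses points near `F x`.
Instead the dichotomy is used: if `F x` were attracting, two more applications of `F` would make `x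
+ 1`, hence `x`, attracting. -/
theorem isRepelling_map (hF : Continuous F) {x : ℝ} (hx : ret F x = x)
    (h2 : ∀ x, ret F x = x → IsAttracting (ret F) x ∨ IsRepelling (ret F) x)
    (h : IsRepelling (ret F) x) : IsRepelling (ret F) (F x) := by
  have hx1 := ret_fixed_map hx
  refine (h2 _ hx1).resolve_left fun ha => ?_
  have := (ha.map hF hx1).map hF (ret_fixed_map hx1)
  rw [map_map_map_of_fixed hx] at this
  exact this.sub_one.not_isRepelling h

theorem map_lt_add_one_of_fixed (h1 : ∀ x, x < F x) {x : ℝ} (hx : ret F x = x) :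
    x < F x ∧ F x < F (F x) ∧ F (F x) < x + 1 :=
  ⟨h1 x, h1 _, by rw [← map_map_map_of_fixed hx]; exact h1 _⟩

/-- The orbit of a fixed point of `ret F` does not return to a gap of the orbit of another one. -/
theorem SameOrbit.eq_of_mem_Ico (h1 : ∀ x, x < F x) {x y z : ℝ} (hx : ret F x = x)
    (hy : y ∈ Set.Ico x (F x)) (hz : z ∈ Set.Ioo x (F x))
    (hyz : SameOrbit F y z) : z = y := by
  obtain ⟨a1, a2, a3⟩ := map_lt_add_one_of_fixed h1 hx
  have b1 := F.monotone hy.1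
  have b2 := F.monotone hy.2.le
  have b3 := F.monotone b1
  have b4 := F.monotone b2
  rw [map_map_map_of_fixed hx] at b4
  have int_lt : ∀ m n : ℤ, (m : ℝ) < n → (m : ℝ) + 1 ≤ n := fun m n h => by
    exact_mod_cast Int.add_one_le_iff.2 (by exact_mod_cast h)
  obtain ⟨hz1, hz2⟩ := hz
  obtain ⟨hy1, hy2⟩ := hy
  -- `y`, `F y` and `F (F y)` lie in the three successive gaps of the orbit of `x`, all within one
  -- turn. Comparing with `z` in the first gap leaves only `z = y + 0`.
  obtain ⟨m, h | h | h⟩ := hyz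
  · have c1 : (m : ℝ) < (1 : ℤ) := by push_cast; linarith
    have c2 : ((-1 : ℤ) : ℝ) < m := by push_cast; linarith
    have c3 := int_lt _ _ c1
    have c4 := int_lt _ _ c2
    push_cast at c3 c4
    linarith
  · have c1 : (m : ℝ) < (0 : ℤ) := by push_cast; linarith
    have c2 : ((-1 : ℤ) : ℝ) < m := by push_cast; linarith
    have c3 := int_lt _ _ c1
    have c4 := int_lt _ _ c2
    push_cast at c3 c4
    linarith
  · have c1 : (m : ℝ) < (0 : ℤ) := by push_cast; linarith
    have c2 : ((-1 : ℤ) : ℝ) < m + 1 := by push_cast; linarith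
    have c3 := int_lt _ _ c1
    push_cast at c3 c2
    have c5 : ((-2 : ℤ) : ℝ) < m := by push_cast; linarith
    have c6 := int_lt _ _ c5
    push_cast at c6
    have : (m : ℝ) = -1 := by linarith
    linarith

/-- With two period-three orbits, all attracting or repelling, every gap of one of them contains
exactly one point of the other one, which has the opposite type. -/
theorem exists_fixed_in_gap (hF : Continuous F) (h1 : ∀ x, x < F x)
    (h2 : ∀ x, ret F x = x → IsAttracting (ret F) x ∨ IsRepelling (ret F) x)
    (h3 : ∀ x y z, ret F x = x → ret F y = y → ret F z = z →
      SameOrbit F x y ∨ SameOrbit F x z ∨ SameOrbit F y z)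
    {x : ℝ} (hx : ret F x = x) :
    ∃ y ∈ Set.Ioo x (F x), ret F y = y ∧ (∀ z ∈ Set.Ioo x (F x), ret F z = z → z = y) ∧
      ((IsAttracting (ret F) x ∧ IsRepelling (ret F) y ∧ (∀ z ∈ Set.Ioo x y, ret F z < z) ∧
          ∀ z ∈ Set.Ioo y (F x), z < ret F z) ∨
        (IsRepelling (ret F) x ∧ IsAttracting (ret F) y ∧ (∀ z ∈ Set.Ioo x y, z < ret F z) ∧
          ∀ z ∈ Set.Ioo y (F x), ret F z < z)) := by
  have hg := ret_continuous hF
  have hex : ∃ y ∈ Set.Ioo x (F x), ret F y = y := by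
    -- `x` and `F x` have the same type, so `ret F y - y` has opposite signs just inside the two
    -- ends of the gap.
    rcases h2 x hx with ha | ha
    · have hb := ha.map hF hx
      obtain ⟨p, hp, hp'⟩ := exists_mem_Ioo_of_eventually_right (h1 x) ha.2
      obtain ⟨q, hq, hq'⟩ := exists_mem_Ioo_of_eventually_left (h1 x) hb.1
      obtain ⟨z, hz, hz'⟩ := exists_fixed_between hg hq' hp'
      exact ⟨z, ⟨(lt_min hq.1 hp.1).trans hz.1, hz.2.trans_le (max_lt hq.2 hp.2).le⟩, hz'⟩
    · have hb := isRepelling_map hF hx h2 ha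
      obtain ⟨p, hp, hp'⟩ := exists_mem_Ioo_of_eventually_right (h1 x) ha.2
      obtain ⟨q, hq, hq'⟩ := exists_mem_Ioo_of_eventually_left (h1 x) hb.1
      obtain ⟨z, hz, hz'⟩ := exists_fixed_between hg hp' hq'
      exact ⟨z, ⟨(lt_min hp.1 hq.1).trans hz.1, hz.2.trans_le (max_lt hp.2 hq.2).le⟩, hz'⟩
  obtain ⟨y, hy, hyf⟩ := hex
  have huniq : ∀ z ∈ Set.Ioo x (F x), ret F z = z → z = y := by
    intro z hz hzf
    have hxm : x ∈ Set.Ico x (F x) := ⟨le_rfl, h1 x⟩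
    -- The orbit of `x` does not enter its own open gap, so of the three coincidences only that of
    -- `y` and `z` is possible.
    rcases h3 x y z hx hyf hzf with h | h | h
    · exact absurd (h.eq_of_mem_Ico h1 hx hxm hy) hy.1.ne'
    · exact absurd (h.eq_of_mem_Ico h1 hx hxm hz) hz.1.ne'
    · exact h.eq_of_mem_Ico h1 hx ⟨hy.1.le, hy.2⟩ hz
  have hno1 : ∀ z ∈ Set.Ioo x y, ret F z ≠ z := fun z hz h =>
    hz.2.ne (huniq z ⟨hz.1, hz.2.trans hy.2⟩ h)
  have hno2 : ∀ z ∈ Set.Ioo y (F x), ret F z ≠ z := fun z hz h =>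
    hz.1.ne' (huniq z ⟨hy.1.trans hz.1, hz.2⟩ h)
  refine ⟨y, hy, hyf, huniq, ?_⟩
  rcases h2 x hx with ha | ha
  · left
    have hb := ha.map hF hx
    obtain ⟨p, hp, hp'⟩ := exists_mem_Ioo_of_eventually_right hy.1 ha.2
    obtain ⟨q, hq, hq'⟩ := exists_mem_Ioo_of_eventually_left hy.2 hb.1
    have c1 := map_lt_of_no_fixed hg hno1 hp hp'
    refine ⟨ha, (h2 y hyf).resolve_left fun h => ?_, c1, lt_map_of_no_fixed hg hno2 hq hq'⟩
    obtain ⟨r, hr, hr'⟩ := exists_mem_Ioo_of_eventually_left hy.1 h.1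
    exact lt_asymm hr' (c1 r hr)
  · right
    have hb := isRepelling_map hF hx h2 ha
    obtain ⟨p, hp, hp'⟩ := exists_mem_Ioo_of_eventually_right hy.1 ha.2
    obtain ⟨q, hq, hq'⟩ := exists_mem_Ioo_of_eventually_left hy.2 hb.1
    have c1 := lt_map_of_no_fixed hg hno1 hp hp'
    refine ⟨ha, (h2 y hyf).resolve_right fun h => ?_, c1, map_lt_of_no_fixed hg hno2 hq hq'⟩
    obtain ⟨r, hr, hr'⟩ := exists_mem_Ioo_of_eventually_left hy.1 h.1
    exact lt_asymm hr' (c1 r hr)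

end orbits

/-! ### From the line to the circle -/

/-- The covering `x ↦ exp (2 π i x)` of the circle. -/
noncomputable def circleTurn (x : ℝ) : Circle := Circle.exp (2 * Real.pi * x)

theorem circleTurn_continuous : Continuous circleTurn :=
  Circle.exp.continuous.comp (by fun_prop)

theorem circleTurn_eq_iff {x y : ℝ} : circleTurn x = circleTurn y ↔ ∃ m : ℤ, x = y + m := by
  rw [circleTurn, circleTurn, Circle.exp_eq_exp]
  have := Real.pi_pos
  refine exists_congr fun m => ⟨fun h => ?_, fun h => by rw [h]; ring⟩
  have h1 : 2 * Real.pi * (x - (y + m)) = 0 := by linarith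
  have h2 := (mul_eq_zero.1 h1).resolve_left (by positivity)
  linarith

theorem circleTurn_add_one (x : ℝ) : circleTurn (x + 1) = circleTurn x :=
  circleTurn_eq_iff.2 ⟨1, by simp⟩

theorem circleTurn_ne {x y : ℝ} (h : x < y) (h' : y < x + 1) : circleTurn x ≠ circleTurn y := by
  rw [Ne, circleTurn_eq_iff]
  rintro ⟨m, hm⟩
  have h1 : (m : ℝ) < (0 : ℤ) := by push_cast; linarith
  have h2 : ((-1 : ℤ) : ℝ) < m := by push_cast; linarith
  have h3 := Int.cast_lt.1 h1
  have h4 := Int.cast_lt.1 h2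
  omega

theorem circleTurn_surjective : Function.Surjective circleTurn := by
  intro z
  obtain ⟨a, rfl⟩ := Circle.exp_surjective z
  have := Real.pi_pos
  exact ⟨a / (2 * Real.pi), by rw [circleTurn]; congr 1; field_simp⟩

theorem exists_circleTurn_eq (x : ℝ) (z : Circle) : ∃ t ∈ Set.Ico x (x + 1), circleTurn t = z := by
  obtain ⟨t, rfl⟩ := circleTurn_surjective z
  refine ⟨toIcoMod one_pos x t, toIcoMod_mem_Ico one_pos x t, ?_⟩
  rw [circleTurn_eq_iff]
  refine ⟨-toIcoDiv one_pos x t, ?_⟩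
  have := toIcoMod_add_toIcoDiv_zsmul one_pos x t
  rw [zsmul_eq_mul, mul_one] at this
  push_cast; linarith

theorem circleTurn_mul_exp (x s : ℝ) :
    circleTurn x * Circle.exp s = circleTurn (x + s / (2 * Real.pi)) := by
  have := Real.pi_pos
  rw [circleTurn, circleTurn, ← Circle.exp_add]; congr 1; field_simp

/-- As `y - x` is less than one turn, the angle of the end point in `arc` must be `2π(y - x)`, which
bounds the angle of `z`. -/
theorem exists_lift_of_mem_arc {x y : ℝ} (h : x ≤ y) (h' : y < x + 1) {z : Circle}
    (hz : z ∈ arc (circleTurn x) (circleTurn y)) : ∃ t ∈ Set.Icc x y, circleTurn t = z := by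
  obtain ⟨s, t, hs, hst, ht, rfl, hv⟩ := hz
  have hpi := Real.pi_pos
  rw [circleTurn_mul_exp] at hv
  have h0 : 0 ≤ t / (2 * Real.pi) := div_nonneg (hs.trans hst) (by positivity)
  have h1 : t / (2 * Real.pi) < 1 := by rw [div_lt_one (by positivity)]; exact ht
  have hty : y = x + t / (2 * Real.pi) := by
    rcases lt_trichotomy y (x + t / (2 * Real.pi)) with hlt | heq | hgt
    · exact absurd hv (circleTurn_ne hlt (by linarith))
    · exact heq
    · exact absurd hv.symm (circleTurn_ne hgt (by linarith))
  refine ⟨x + s / (2 * Real.pi), ⟨?_, ?_⟩, (circleTurn_mul_exp x s).symm⟩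
  · have : 0 ≤ s / (2 * Real.pi) := by positivity
    linarith
  · rw [hty]
    have : s / (2 * Real.pi) ≤ t / (2 * Real.pi) := by gcongr
    linarith

/-! ### From the dynamics of the lift to the dynamics of `ψ` -/

section semiconj

variable {F : CircleDeg1Lift} {ψ : Circle → Circle}

theorem iterate_three_circleTurn (hψ : ∀ x, circleTurn (F x) = ψ (circleTurn x)) (x : ℝ) :
    ψ^[3] (circleTurn x) = circleTurn (ret F x) := by
  rw [← circleTurn_add_one (ret F x), ret, sub_add_cancel, hψ, hψ, hψ]; rfl

theorem iterate_circleTurn (hψ : ∀ x, circleTurn (F x) = ψ (circleTurn x)) (n : ℕ) (x : ℝ) :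
    ψ^[3 * n] (circleTurn x) = circleTurn ((ret F)^[n] x) := by
  rw [Function.iterate_mul]
  induction n generalizing x with
  | zero => rfl
  | succ n ih =>
    rw [Function.iterate_succ_apply, Function.iterate_succ_apply (ret F),
      iterate_three_circleTurn hψ, ih]

theorem tendsto_circleTurn (hψ : ∀ x, circleTurn (F x) = ψ (circleTurn x)) {x b : ℝ}
    (h : Tendsto (fun n => (ret F)^[n] x) atTop (𝓝 b)) :
    Tendsto (fun n : ℕ => ψ^[3 * n] (circleTurn x)) atTop (𝓝 (circleTurn b)) := by
  simp only [iterate_circleTurn hψ]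
  exact (circleTurn_continuous.tendsto b).comp h

/-- A rotation whose cube fixes one point has cube the identity, so a conjugate map would have the
whole infinite circle as period-three points. -/
theorem not_isConjugateToRotation {f : Circle → Circle} {l : List Circle} (u : Circle)
    (hu : f^[3] u = u) (h : ∀ z, f^[3] z = z → z ∈ l) : ¬ IsConjugateToRotation f := by
  rintro ⟨g, a, hg⟩
  have h3 : ∀ v, g (f^[3] v) = a * (a * (a * g v)) := by
    intro v
    show g (f (f (f v))) = _
    rw [hg, hg, hg]
  have ha : a * (a * a) = 1 := by
    have := h3 u
    rw [hu, ← mul_assoc, ← mul_assoc] at this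
    have h4 := mul_right_cancel (this.symm.trans (one_mul (g u)).symm)
    rw [← mul_assoc]; exact h4
  have hall : ∀ v, v ∈ l := by
    intro v
    refine h v (g.injective ?_)
    rw [h3, ← mul_assoc, ← mul_assoc, mul_assoc a a a, ha, one_mul]
  have hfin : (Set.univ : Set Circle).Finite :=
    (List.finite_toSet l).subset fun v _ => hall v
  have hinf : (Set.Ico (0 : ℝ) 1).Infinite := Set.Ico_infinite one_pos
  refine hinf (Set.Finite.of_finite_image (f := circleTurn) (hfin.subset (Set.subset_univ _)) ?_)
  intro x hx y hy hxy
  rcases lt_trichotomy x y with hlt | heq | hgt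
  · exact absurd hxy (circleTurn_ne hlt (by linarith [hx.1, hy.2]))
  · exact heq
  · exact absurd hxy.symm (circleTurn_ne hgt (by linarith [hy.1, hx.2]))

theorem SameOrbit.circleTurn_eq (hψ : ∀ x, circleTurn (F x) = ψ (circleTurn x)) {x y : ℝ}
    (h : SameOrbit F x y) : circleTurn y = circleTurn x ∨ circleTurn y = ψ (circleTurn x) ∨
      circleTurn y = ψ^[2] (circleTurn x) := by
  have key : ∀ (z : ℝ) (m : ℤ), circleTurn (z + m) = circleTurn z := fun z m =>
    circleTurn_eq_iff.2 ⟨m, rfl⟩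
  obtain ⟨m, rfl | rfl | rfl⟩ := h
  · left; exact key _ _
  · right; left; rw [key, hψ]
  · right; right; rw [key, hψ, hψ]; rfl

/-- A single semi-stable orbit of period three: dynamics. -/
theorem semistable_dynamics (hF : Continuous F) (h1 : ∀ x, x < F x)
    (hψ : ∀ x, circleTurn (F x) = ψ (circleTurn x))
    (hfix : ∀ x, ψ^[3] (circleTurn x) = circleTurn x → ret F x = x)
    (h2 : ∀ x, ret F x = x → ∀ᶠ y in 𝓝[<] x, y < ret F y)
    (h3 : ∀ x y, ret F x = x → ret F y = y → SameOrbit F x y)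
    (u₁ u₂ u₃ : Circle) (hu₁ : ψ^[3] u₁ = u₁) (hu₂ : u₂ = ψ u₁) (hu₃ : u₃ = ψ^[2] u₁) :
    [u₁, u₂, u₃].Nodup ∧
      (∀ z, ψ^[3] z = z → z ∈ [u₁, u₂, u₃]) ∧
      (∀ z ∈ arc u₃ u₁ \ {u₃}, Tendsto (fun n : ℕ => ψ^[3 * n] z) atTop (𝓝 u₁)) ∧
      (∀ z ∈ arc u₁ u₂ \ {u₁}, Tendsto (fun n : ℕ => ψ^[3 * n] z) atTop (𝓝 u₂)) ∧
      (∀ z ∈ arc u₂ u₃ \ {u₂}, Tendsto (fun n : ℕ => ψ^[3 * n] z) atTop (𝓝 u₃)) := by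
  obtain ⟨x, rfl⟩ := circleTurn_surjective u₁
  have hx := hfix x hu₁
  have e2 : ψ^[2] (circleTurn x) = circleTurn (F (F x)) := by rw [hψ, hψ]; rfl
  rw [e2] at hu₃
  rw [← hψ] at hu₂
  subst hu₂ hu₃
  have hx1 := ret_fixed_map hx
  have hx2 := ret_fixed_map hx1
  have hx3 := map_map_map_of_fixed hx
  obtain ⟨a1, a2, a3⟩ := map_lt_add_one_of_fixed h1 hx
  have conv : ∀ x, ret F x = x → F x < x + 1 → ∀ z ∈ arc (circleTurn x) (circleTurn (F x)) \
      {circleTurn x}, Tendsto (fun n : ℕ => ψ^[3 * n] z) atTop (𝓝 (circleTurn (F x))) := by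
    rintro x hx hlt z ⟨hz, hzx⟩
    obtain ⟨t, ht, rfl⟩ := exists_lift_of_mem_arc (h1 x).le hlt hz
    have hno : ∀ z ∈ Set.Ioo x (F x), ret F z ≠ z := fun z hz h =>
      hz.1.ne' ((h3 x z hx h).eq_of_mem_Ico h1 hx ⟨le_rfl, h1 x⟩ hz)
    -- Points just before `F x` move forward, and there is no fixed point inside the gap, so the
    -- whole gap moves forward to `F x`.
    obtain ⟨q, hq, hq'⟩ := exists_mem_Ioo_of_eventually_left (h1 x) (h2 _ (ret_fixed_map hx))
    exact tendsto_circleTurn hψ (tendsto_iterate_right (ret_continuous hF) (ret_monotone F)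
      (ret_fixed_map hx) (lt_map_of_no_fixed (ret_continuous hF) hno hq hq')
      ⟨lt_of_le_of_ne ht.1 (by rintro rfl; exact hzx rfl), ht.2⟩)
  refine ⟨?_, ?_, ?_, conv x hx (by linarith), conv _ hx1 (by linarith)⟩
  · simp only [List.nodup_cons, List.mem_cons, List.not_mem_nil, or_false, not_or,
      not_false_eq_true, List.nodup_nil, and_true]
    exact ⟨⟨circleTurn_ne a1 (by linarith), circleTurn_ne (a1.trans a2) a3⟩,
      circleTurn_ne a2 (by linarith)⟩
  · intro z hz
    obtain ⟨t, rfl⟩ := circleTurn_surjective z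
    have := (h3 x t hx (hfix t hz)).circleTurn_eq hψ
    rw [e2, ← hψ] at this
    simpa using this
  · have := conv _ hx2 (by linarith)
    rwa [hx3, circleTurn_add_one] at this

section hyperbolic

/-- On fixed points of `ret F` the map `F³` is translation by one, so `F` is injective there. -/
theorem map_lt_map_of_fixed {x y : ℝ} (hx : ret F x = x) (hy : ret F y = y) (h : x < y) :
    F x < F y := by
  refine lt_of_le_of_ne (F.monotone h.le) fun he => ?_
  have h1 := map_map_map_of_fixed hx
  rw [he, map_map_map_of_fixed hy] at h1
  linarith

theorem tendsto_in_gap (hF : Continuous F) (h1 : ∀ x, x < F x)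
    (h2 : ∀ x, ret F x = x → IsAttracting (ret F) x ∨ IsRepelling (ret F) x)
    (h3 : ∀ x y z, ret F x = x → ret F y = y → ret F z = z →
      SameOrbit F x y ∨ SameOrbit F x z ∨ SameOrbit F y z)
    {x y : ℝ} (hx : ret F x = x) (hxa : IsAttracting (ret F) x)
    (hy : ret F y = y) (hxy : y ∈ Set.Ioo x (F x)) :
    (∀ t ∈ Set.Ico x y, Tendsto (fun n => (ret F)^[n] t) atTop (𝓝 x)) ∧
      ∀ t ∈ Set.Ioc y (F x), Tendsto (fun n => (ret F)^[n] t) atTop (𝓝 (F x)) := by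
  obtain ⟨y', hy', -, hu, h⟩ := exists_fixed_in_gap hF h1 h2 h3 hx
  obtain rfl := hu y hxy hy
  rcases h with ⟨-, -, h4, h5⟩ | ⟨h, -⟩
  · exact ⟨fun t ht => tendsto_iterate_left (ret_continuous hF) (ret_monotone F) hx h4 ht,
      fun t ht => tendsto_iterate_right (ret_continuous hF) (ret_monotone F)
        (ret_fixed_map hx) h5 ht⟩
  · exact absurd h hxa.not_isRepelling

/-- The arc from `y` to `F y` contains `F x`. Its first part lies in the gap from `x` to `F x`, its
second part in the next gap, and both are drawn to `F x`. -/
theorem tendsto_of_mem_arc (hF : Continuous F) (h1 : ∀ x, x < F x)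
    (h2 : ∀ x, ret F x = x → IsAttracting (ret F) x ∨ IsRepelling (ret F) x)
    (h3 : ∀ x y z, ret F x = x → ret F y = y → ret F z = z →
      SameOrbit F x y ∨ SameOrbit F x z ∨ SameOrbit F y z)
    (hψ : ∀ x, circleTurn (F x) = ψ (circleTurn x)) {x y : ℝ}
    (hx : ret F x = x) (hxa : IsAttracting (ret F) x)
    (hy : ret F y = y) (hxy : y ∈ Set.Ioo x (F x)) (z : Circle)
    (hz : z ∈ arc (circleTurn y) (circleTurn (F y)) \ {circleTurn y, circleTurn (F y)}) :
    Tendsto (fun n : ℕ => ψ^[3 * n] z) atTop (𝓝 (circleTurn (F x))) := by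
  obtain ⟨b1, b2, b3⟩ := map_lt_add_one_of_fixed h1 hy
  obtain ⟨hz, hz'⟩ := hz
  obtain ⟨t, ht, rfl⟩ := exists_lift_of_mem_arc b1.le (by linarith) hz
  have ht1 : y < t := lt_of_le_of_ne ht.1 (by rintro rfl; exact hz' (Or.inl rfl))
  have ht2 : t < F y := lt_of_le_of_ne ht.2 (by rintro rfl; exact hz' (Or.inr rfl))
  have hx1 := ret_fixed_map hx
  rcases le_or_gt t (F x) with h | h
  · exact tendsto_circleTurn hψ ((tendsto_in_gap hF h1 h2 h3 hx hxa hy hxy).2 t ⟨ht1, h⟩)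
  · exact tendsto_circleTurn hψ ((tendsto_in_gap hF h1 h2 h3 hx1 (hxa.map hF hx)
      (ret_fixed_map hy) ⟨map_lt_map_of_fixed hx hy hxy.1,
        map_lt_map_of_fixed hy hx1 hxy.2⟩).1 t ⟨h.le, ht2⟩)

theorem exists_attracting (hF : Continuous F) (h1 : ∀ x, x < F x)
    (h2 : ∀ x, ret F x = x → IsAttracting (ret F) x ∨ IsRepelling (ret F) x)
    (h3 : ∀ x y z, ret F x = x → ret F y = y → ret F z = z →
      SameOrbit F x y ∨ SameOrbit F x z ∨ SameOrbit F y z)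
    {x : ℝ} (hx : ret F x = x) :
    ∃ y, ret F y = y ∧ IsAttracting (ret F) y := by
  obtain ⟨y, -, hyf, -, h⟩ := exists_fixed_in_gap hF h1 h2 h3 hx
  rcases h with h | h
  · exact ⟨x, hx, h.1⟩
  · exact ⟨y, hyf, h.2.1⟩

/-- A repelling periodic orbit attracts no other point. -/
theorem isAttracting_of_tendsto (hF : Continuous F) (h1 : ∀ x, x < F x)
    (h2 : ∀ x, ret F x = x → IsAttracting (ret F) x ∨ IsRepelling (ret F) x)
    (h3 : ∀ x y z, ret F x = x → ret F y = y → ret F z = z →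
      SameOrbit F x y ∨ SameOrbit F x z ∨ SameOrbit F y z)
    (hψ : ∀ x, circleTurn (F x) = ψ (circleTurn x)) {x : ℝ} (hx : ret F x = x) {w : Circle}
    (hw : w ∉ [circleTurn x, circleTurn (F x), circleTurn (F (F x))])
    (hlim : Tendsto (fun n : ℕ => ψ^[3 * n] w) atTop (𝓝 (circleTurn x))) :
    IsAttracting (ret F) x := by
  refine (h2 x hx).resolve_right fun hr => ?_
  have hr1 := isRepelling_map hF hx h2 hr
  have hx1 := ret_fixed_map hx
  have hr2 := isRepelling_map hF hx1 h2 hr1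
  have hx2 := ret_fixed_map hx1
  have hx3 := map_map_map_of_fixed hx
  obtain ⟨a1, a2, a3⟩ := map_lt_add_one_of_fixed h1 hx
  obtain ⟨t, ht, rfl⟩ := exists_circleTurn_eq x w
  -- If the orbit repels, every point strictly inside one of its gaps converges to the attracting
  -- point in that gap, so the limit of `w` could not be on the orbit.
  have key : ∀ p, ret F p = p → IsRepelling (ret F) p → t ∈ Set.Ioo p (F p) →
      ∃ y ∈ Set.Ioo p (F p), Tendsto (fun n => (ret F)^[n] t) atTop (𝓝 y) := by
    intro p hp hpr htp
    obtain ⟨y, hy, hyf, -, h⟩ := exists_fixed_in_gap hF h1 h2 h3 hp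
    obtain ⟨-, -, h4, h5⟩ := h.resolve_left fun h => h.1.not_isRepelling hpr
    refine ⟨y, hy, ?_⟩
    rcases le_or_gt t y with hty | hty
    · exact tendsto_iterate_right (ret_continuous hF) (ret_monotone F) hyf h4 ⟨htp.1, hty⟩
    · exact tendsto_iterate_left (ret_continuous hF) (ret_monotone F) hyf h5 ⟨hty.le, htp.2⟩
  simp only [List.mem_cons, List.not_mem_nil, or_false, not_or] at hw
  obtain ⟨w1, w2, w3⟩ := hw
  have hlim' : ∃ y ∈ Set.Ioo x (x + 1), Tendsto (fun n => (ret F)^[n] t) atTop (𝓝 y) := by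
    have ht1 : x < t := lt_of_le_of_ne ht.1 (by rintro rfl; exact w1 rfl)
    rcases lt_trichotomy t (F x) with h | h | h
    · obtain ⟨y, hy, hl⟩ := key x hx hr ⟨ht1, h⟩
      exact ⟨y, ⟨hy.1, by linarith [hy.2]⟩, hl⟩
    · exact absurd (by rw [h]) w2
    rcases lt_trichotomy t (F (F x)) with h' | h' | h'
    · obtain ⟨y, hy, hl⟩ := key _ hx1 hr1 ⟨h, h'⟩
      exact ⟨y, ⟨by linarith [hy.1], by linarith [hy.2]⟩, hl⟩
    · exact absurd (by rw [h']) w3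
    · obtain ⟨y, hy, hl⟩ := key _ hx2 hr2 ⟨h', by rw [hx3]; exact ht.2⟩
      rw [hx3] at hy
      exact ⟨y, ⟨by linarith [hy.1], hy.2⟩, hl⟩
  obtain ⟨y, hy, hl⟩ := hlim'
  exact circleTurn_ne hy.1 hy.2 (tendsto_nhds_unique hlim (tendsto_circleTurn hψ hl))

/-- An attracting and a repelling orbit of period three: existence of an attracted point. -/
theorem hyperbolic_exists (hF : Continuous F) (h1 : ∀ x, x < F x)
    (h2 : ∀ x, ret F x = x → IsAttracting (ret F) x ∨ IsRepelling (ret F) x)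
    (h3 : ∀ x y z, ret F x = x → ret F y = y → ret F z = z →
      SameOrbit F x y ∨ SameOrbit F x z ∨ SameOrbit F y z)
    (hψ : ∀ x, circleTurn (F x) = ψ (circleTurn x)) {x : ℝ} (hx0 : ret F x = x) :
    ∃ u₁, ψ^[3] u₁ = u₁ ∧ ∃ w, w ∉ [u₁, ψ u₁, ψ^[2] u₁] ∧
        Tendsto (fun n : ℕ => ψ^[3 * n] w) atTop (𝓝 u₁) := by
  obtain ⟨x, hx, hxa⟩ := exists_attracting hF h1 h2 h3 hx0
  have e2 : ψ^[2] (circleTurn x) = circleTurn (F (F x)) := by rw [hψ, hψ]; rfl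
  obtain ⟨y, hy, hyf, -⟩ := exists_fixed_in_gap hF h1 h2 h3 hx
  obtain ⟨a1, a2, a3⟩ := map_lt_add_one_of_fixed h1 hx
  have hm1 : x < (x + y) / 2 := by linarith [hy.1]
  have hm2 : (x + y) / 2 < y := by linarith [hy.1]
  have := hy.2
  refine ⟨circleTurn x, by rw [iterate_three_circleTurn hψ, hx], circleTurn ((x + y) / 2), ?_,
    tendsto_circleTurn hψ ((tendsto_in_gap hF h1 h2 h3 hx hxa hyf hy).1 _ ⟨hm1.le, hm2⟩)⟩
  rw [e2, ← hψ]
  simp only [List.mem_cons, List.not_mem_nil, or_false, not_or]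
  exact ⟨(circleTurn_ne hm1 (by linarith)).symm, circleTurn_ne (by linarith) (by linarith),
    circleTurn_ne (by linarith) (by linarith)⟩

/-- An attracting and a repelling orbit of period three: dynamics. -/
theorem hyperbolic_dynamics (hF : Continuous F) (h1 : ∀ x, x < F x)
    (h2 : ∀ x, ret F x = x → IsAttracting (ret F) x ∨ IsRepelling (ret F) x)
    (h3 : ∀ x y z, ret F x = x → ret F y = y → ret F z = z →
      SameOrbit F x y ∨ SameOrbit F x z ∨ SameOrbit F y z)
    (hψ : ∀ x, circleTurn (F x) = ψ (circleTurn x))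
    (hfix : ∀ x, ψ^[3] (circleTurn x) = circleTurn x → ret F x = x)
    (u₁ u₂ u₃ : Circle) (hu₁ : ψ^[3] u₁ = u₁) (hu₂ : u₂ = ψ u₁) (hu₃ : u₃ = ψ^[2] u₁)
    (hw : ∃ w, w ∉ [u₁, u₂, u₃] ∧ Tendsto (fun n : ℕ => ψ^[3 * n] w) atTop (𝓝 u₁)) :
    (∃ v₁ ∈ arc u₁ u₂ \ {u₁}, v₁ ≠ u₂ ∧ ψ^[3] v₁ = v₁) ∧
      ∀ v₁ v₂ v₃, v₁ ∈ arc u₁ u₂ \ {u₁} → v₁ ≠ u₂ → ψ^[3] v₁ = v₁ →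
        v₂ = ψ v₁ → v₃ = ψ^[2] v₁ →
        [u₁, u₂, u₃, v₁, v₂, v₃].Nodup ∧
        (∀ z, ψ^[3] z = z → z ∈ [u₁, u₂, u₃, v₁, v₂, v₃]) ∧
        (∀ z ∈ arc v₃ v₁ \ {v₃, v₁}, Tendsto (fun n : ℕ => ψ^[3 * n] z) atTop (𝓝 u₁)) ∧
        (∀ z ∈ arc v₁ v₂ \ {v₁, v₂}, Tendsto (fun n : ℕ => ψ^[3 * n] z) atTop (𝓝 u₂)) ∧
        (∀ z ∈ arc v₂ v₃ \ {v₂, v₃}, Tendsto (fun n : ℕ => ψ^[3 * n] z) atTop (𝓝 u₃)) := by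
  obtain ⟨x, rfl⟩ := circleTurn_surjective u₁
  have hx := hfix x hu₁
  have e2 : ∀ x, ψ^[2] (circleTurn x) = circleTurn (F (F x)) := fun x => by rw [hψ, hψ]; rfl
  rw [e2] at hu₃
  rw [← hψ] at hu₂
  subst hu₂ hu₃
  obtain ⟨w, hw, hlim⟩ := hw
  have hxa := isAttracting_of_tendsto hF h1 h2 h3 hψ hx hw hlim
  have hx1 := ret_fixed_map hx
  have hx2 := ret_fixed_map hx1
  have hx3 := map_map_map_of_fixed hx
  obtain ⟨a1, a2, a3⟩ := map_lt_add_one_of_fixed h1 hx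
  constructor
  · obtain ⟨y, hy, hyf, -⟩ := exists_fixed_in_gap hF h1 h2 h3 hx
    have := hy.1
    have := hy.2
    have hpi := Real.pi_pos
    refine ⟨circleTurn y, ⟨⟨2 * Real.pi * (y - x), 2 * Real.pi * (F x - x), ?_, ?_, ?_, ?_, ?_⟩,
      ?_⟩, ?_, ?_⟩
    · exact mul_nonneg (by positivity) (by linarith)
    · exact mul_le_mul_of_nonneg_left (by linarith) (by positivity)
    · nlinarith
    · rw [circleTurn_mul_exp]; congr 1; field_simp; ring
    · rw [circleTurn_mul_exp]; congr 1; field_simp; ring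
    · exact (circleTurn_ne hy.1 (by linarith)).symm
    · exact circleTurn_ne hy.2 (by linarith)
    · rw [iterate_three_circleTurn hψ, hyf]
  · intro v₁ v₂ v₃ hv₁ hne hf hv₂ hv₃
    obtain ⟨hv₁, hv₁'⟩ := hv₁
    obtain ⟨y, hy, rfl⟩ := exists_lift_of_mem_arc a1.le (by linarith) hv₁
    have hyf := hfix y hf
    rw [e2] at hv₃
    rw [← hψ] at hv₂
    subst hv₂ hv₃
    have b1 : x < y := lt_of_le_of_ne hy.1 (by rintro rfl; exact hv₁' rfl)
    have b2 : y < F x := lt_of_le_of_ne hy.2 (by rintro rfl; exact hne rfl)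
    have hy1 := ret_fixed_map hyf
    have hy2 := ret_fixed_map hy1
    have hy3 := map_map_map_of_fixed hyf
    have b3 := map_lt_map_of_fixed hx hyf b1
    have b4 := map_lt_map_of_fixed hyf hx1 b2
    have b5 := map_lt_map_of_fixed hx1 hy1 b3
    have b6 := map_lt_map_of_fixed hy1 hx2 b4
    have hxa1 := hxa.map hF hx
    have hxa2 := hxa1.map hF hx1
    refine ⟨?_, ?_, ?_, tendsto_of_mem_arc hF h1 h2 h3 hψ hx hxa hyf ⟨b1, b2⟩,
      tendsto_of_mem_arc hF h1 h2 h3 hψ hx1 hxa1 hy1 ⟨b3, b4⟩⟩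
    · rw [hx3] at b6
      have n : ∀ {p q : ℝ}, p < q → q < p + 1 → circleTurn p ≠ circleTurn q := circleTurn_ne
      simp only [List.nodup_cons, List.mem_cons, List.not_mem_nil, or_false, not_or,
        not_false_eq_true, List.nodup_nil, and_true]
      refine ⟨⟨n ?_ ?_, n ?_ ?_, n ?_ ?_, n ?_ ?_, n ?_ ?_⟩,
        ⟨n ?_ ?_, (n ?_ ?_).symm, n ?_ ?_, n ?_ ?_⟩, ⟨(n ?_ ?_).symm, (n ?_ ?_).symm, n ?_ ?_⟩,
        ⟨n ?_ ?_, n ?_ ?_⟩, n ?_ ?_⟩ <;> linarith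
    · intro z hz
      obtain ⟨t, rfl⟩ := circleTurn_surjective z
      rcases h3 x y t hx hyf (hfix t hz) with h | h | h
      · exact absurd (h.eq_of_mem_Ico h1 hx ⟨le_rfl, a1⟩ ⟨b1, b2⟩) b1.ne'
      · have := h.circleTurn_eq hψ
        rw [e2, ← hψ] at this
        simp only [List.mem_cons]
        tauto
      · have := h.circleTurn_eq hψ
        rw [e2, ← hψ] at this
        simp only [List.mem_cons]
        tauto
    · have := tendsto_of_mem_arc hF h1 h2 h3 hψ hx2 hxa2 hy2 ⟨b5, b6⟩
      rwa [hx3, hy3, circleTurn_add_one, circleTurn_add_one] at this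

end hyperbolic

end semiconj

open ComplexConjugate

/-! ### Chords through a point and the Möbius involutions they define -/

/-- `X` lies strictly between `v` and `w` on the chord `vw`. -/
def OnChord (X v w : ℂ) : Prop := ∃ s ∈ Set.Ioo (0 : ℝ) 1, X = v + s * (w - v)

/-- The equation of the line through two points `v, w` of the unit circle. -/
def ChordEq (X v w : ℂ) : Prop := v + w = X + conj X * v * w

theorem coe_mul_conj (v : Circle) : (v : ℂ) * conj (v : ℂ) = 1 := by
  rw [Complex.mul_conj, Circle.normSq_coe]; simp

theorem OnChord.chordEq {X : ℂ} {v w : Circle} (h : OnChord X v w) : ChordEq X v w := by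
  obtain ⟨s, -, rfl⟩ := h
  have hv := coe_mul_conj v
  have hw := coe_mul_conj w
  simp only [ChordEq, map_add, map_mul, map_sub, Complex.conj_ofReal]
  linear_combination (-(w : ℂ) + s * w) * hv - (s : ℂ) * v * hw

theorem ChordEq.symm {X v w : ℂ} (h : ChordEq X v w) : ChordEq X w v := by
  unfold ChordEq at *; linear_combination h

theorem one_sub_conj_mul_ne_zero {X : ℂ} (hX : ‖X‖ < 1) (v : Circle) :
    1 - conj X * (v : ℂ) ≠ 0 := by
  intro h
  have : ‖conj X * (v : ℂ)‖ = 1 := by rw [← sub_eq_zero.1 h]; simp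
  rw [norm_mul, RCLike.norm_conj, Circle.norm_coe, mul_one] at this
  linarith

/-- The chord equation is linear in `w` with coefficient `1 - X̄v ≠ 0`; its solution is the
involution `w = (X - v) / (1 - X̄v)`. -/
theorem ChordEq.unique {X : ℂ} (hX : ‖X‖ < 1) {v : Circle} {w w' : ℂ} (h : ChordEq X v w)
    (h' : ChordEq X v w') : w = w' := by
  refine sub_eq_zero.1 ((mul_eq_zero.1 ?_).resolve_left (one_sub_conj_mul_ne_zero hX v))
  unfold ChordEq at *; linear_combination h - h'

/-- For `z = v + t(w - v)` one has `|z|² = 1 - t(1 - t)|w - v|²`, so `|z| < 1` forces `0 < t < 1`.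
-/
theorem onChord_of_im_eq_zero {v w : Circle} (hvw : v ≠ w) {z : ℂ} (hz : ‖z‖ < 1)
    (h : (conj ((w : ℂ) - v) * (z - v)).im = 0) : OnChord z v w := by
  have hc : (w : ℂ) - v ≠ 0 := fun h0 => hvw (Circle.ext (sub_eq_zero.1 h0)).symm
  have hn := Complex.normSq_pos.2 hc
  set r := (conj ((w : ℂ) - v) * (z - v)).re
  have hr : conj ((w : ℂ) - v) * (z - v) = (r : ℂ) := Complex.ext rfl (by simpa using h)
  set N := Complex.normSq ((w : ℂ) - v) with hN
  have hNc : (N : ℂ) = conj ((w : ℂ) - v) * (w - v) := by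
    rw [hN, ← Complex.normSq_eq_conj_mul_self]
  have hN0 : (N : ℂ) ≠ 0 := by exact_mod_cast hn.ne'
  obtain ⟨t, ht⟩ : ∃ t : ℝ, t = r / N := ⟨_, rfl⟩
  have hzt : z = v + t * ((w : ℂ) - v) := by
    have h1 : (N : ℂ) * (z - v) = r * ((w : ℂ) - v) := by
      rw [hNc, ← hr]; ring
    rw [ht]; push_cast; field_simp; linear_combination h1
  have hv := coe_mul_conj v
  have hw := coe_mul_conj w
  have hnorm : z * conj z = 1 - t * (1 - t) * N := by
    rw [hNc, hzt]
    simp only [map_add, map_mul, map_sub, Complex.conj_ofReal]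
    linear_combination (1 - (t : ℂ)) * hv + (t : ℂ) * hw
  rw [Complex.mul_conj] at hnorm
  have h2 : Complex.normSq z = 1 - t * (1 - t) * N := by exact_mod_cast hnorm
  have h3 : Complex.normSq z < 1 := by
    rw [Complex.normSq_eq_norm_sq]; nlinarith [norm_nonneg z]
  have h4 : 0 < t * (1 - t) := by
    by_contra! h5
    nlinarith
  refine ⟨t, ⟨?_, ?_⟩, hzt⟩ <;> nlinarith

theorem triangle_subset_ball {P Q R : ℂ} (hT : IsTriangleInDisk P Q R) :
    triangle P Q R ⊆ Metric.ball (0 : ℂ) 1 := by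
  obtain ⟨-, hP, hQ, hR⟩ := hT
  refine convexHull_min ?_ (convex_ball _ _)
  rintro X (rfl | rfl | rfl) <;> simpa

theorem interior_triangle_nonempty {P Q R : ℂ} (hT : IsTriangleInDisk P Q R) :
    (interior (triangle P Q R)).Nonempty := by
  have h := hT.1.affineSpan_eq_top_iff_card_eq_finrank_add_one.2 (by simp)
  have e : ({P, Q, R} : Set ℂ) = Set.range ![P, Q, R] := by
    ext z; simp [eq_comm]; tauto
  rw [triangle, e]
  exact interior_convexHull_nonempty_iff_affineSpan_eq_top.2 h

/-- A tangent chord contains a vertex of the triangle. -/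
theorem IsTangentChord.exists_onChord {P Q R : ℂ} (hT : IsTriangleInDisk P Q R) {v w : Circle}
    (h : IsTangentChord P Q R v w) :
    v ≠ w ∧ ∃ X ∈ ({P, Q, R} : Set ℂ), OnChord X v w := by
  obtain ⟨⟨z, hz, hzT⟩, hdis⟩ := h
  have hball := triangle_subset_ball hT
  have hnorm : ∀ z ∈ triangle P Q R, ‖z‖ < 1 := fun z h => by simpa using hball h
  have hvw : v ≠ w := by
    rintro rfl
    rw [segment_same, Set.mem_singleton_iff] at hz
    have := hnorm z hzT
    rw [hz, Circle.norm_coe] at this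
    exact lt_irrefl _ this
  refine ⟨hvw, ?_⟩
  by_contra! hno
  have hVT : ∀ X ∈ ({P, Q, R} : Set ℂ), X ∈ triangle P Q R := fun X hX =>
    subset_convexHull ℝ _ hX
  set c : ℂ := conj ((w : ℂ) - v) with hc
  have hint : ∀ y ∈ interior (triangle P Q R), (c * (y - v)).im ≠ 0 := by
    intro y hy h0
    obtain ⟨s, hs, hys⟩ := onChord_of_im_eq_zero hvw (hnorm y (interior_subset hy)) h0
    refine Set.disjoint_left.1 hdis ?_ hy
    rw [segment_eq_image']
    exact ⟨s, ⟨hs.1.le, hs.2.le⟩, by rw [hys]; simp⟩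
  have hver : ∀ X ∈ ({P, Q, R} : Set ℂ), (c * (X - v)).im ≠ 0 := fun X hX h0 =>
    hno X hX (onChord_of_im_eq_zero hvw (hnorm X (hVT X hX)) h0)
  have hz0 : (c * (z - v)).im = 0 := by
    rw [segment_eq_image'] at hz
    obtain ⟨a, -, rfl⟩ := hz
    have : c * ((v : ℂ) + a • ((w : ℂ) - v) - v) =
        ((a * Complex.normSq ((w : ℂ) - v) : ℝ) : ℂ) := by
      rw [Complex.ofReal_mul, Complex.normSq_eq_conj_mul_self, Complex.real_smul]; ring
    rw [this, Complex.ofReal_im]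
  obtain ⟨y, hy⟩ := interior_triangle_nonempty hT
  obtain ⟨ε, hε⟩ : ∃ ε : ℝ, 0 < ε * (c * (y - v)).im := by
    rcases lt_or_gt_of_ne (hint y hy) with h | h
    · exact ⟨-1, by linarith⟩
    · exact ⟨1, by linarith⟩
  -- If the chord avoids all vertices, each vertex is strictly on the side of the interior point
  -- `y`; otherwise the segment from that vertex to `y` would cross the line of the chord at an
  -- interior point of the triangle. The whole triangle then misses the chord.
  have hside : ∀ X ∈ ({P, Q, R} : Set ℂ), 0 < ε * (c * (X - v)).im := by
    intro X hX
    by_contra! hle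
    have hε0 : ε ≠ 0 := by rintro rfl; simp at hε
    have hlt : ε * (c * (X - v)).im < 0 :=
      lt_of_le_of_ne hle (mul_ne_zero hε0 (hver X hX))
    set p := ε * (c * (X - v)).im with hp
    set q := ε * (c * (y - v)).im with hq
    have hpq : 0 < q - p := by linarith
    -- At the parameter `-p / (q - p)` the affine side function, equal to `p` at `X` and `q` at `y`,
    -- vanishes.
    have hmem := (convex_convexHull ℝ ({P, Q, R} : Set ℂ)).add_smul_sub_mem_interior
      (hVT X hX) hy (t := -p / (q - p))
      ⟨div_pos (by linarith) hpq, (div_le_one hpq).2 (by linarith)⟩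
    refine hint _ hmem ?_
    have h1 : c * (X + (-p / (q - p)) • (y - X) - v) =
        c * (X - v) + ((-p / (q - p) : ℝ) : ℂ) * (c * (y - v) - c * (X - v)) := by
      rw [Complex.real_smul]; ring
    rw [h1, Complex.add_im, Complex.im_ofReal_mul, Complex.sub_im]
    have h2 : ε * ((c * (X - v)).im + -p / (q - p) *
        ((c * (y - v)).im - (c * (X - v)).im)) = 0 := by
      have : ε * ((c * (X - v)).im + -p / (q - p) *
        ((c * (y - v)).im - (c * (X - v)).im)) = p + -p / (q - p) * (q - p) := by
        rw [hp, hq]; ring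
      rw [this]; field_simp; ring
    exact (mul_eq_zero.1 h2).resolve_left hε0
  have hsub : triangle P Q R ⊆ {X : ℂ | ε * (c * v).im < ε * (c * X).im} := by
    refine convexHull_min ?_ (convex_halfSpace_gt
      (⟨fun x y => by simp [mul_add], fun a x => by simp; ring⟩ :
        IsLinearMap ℝ fun X : ℂ => ε * (c * X).im) _)
    intro X hX
    have := hside X hX
    rw [mul_sub, Complex.sub_im, mul_sub] at this
    rw [Set.mem_ofPred_eq]; linarith
  have h1 := hsub hzT
  rw [Set.mem_ofPred_eq] at h1
  rw [mul_sub, Complex.sub_im, sub_eq_zero] at hz0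
  rw [hz0] at h1
  exact lt_irrefl _ h1

/-! ### The Möbius transformation of three consecutive chords -/

/-- Diagonal coefficient of the product of the three chord involutions. -/
noncomputable def coeffA (X Y Z : ℂ) : ℂ :=
  Complex.I * (1 - Y * conj X - Z * conj Y + Z * conj X)

/-- Off-diagonal coefficient of the product of the three chord involutions. -/
noncomputable def coeffB (X Y Z : ℂ) : ℂ := Complex.I * (Y - X - Z + Z * X * conj Y)

/-- Twice the signed area of the triangle `XYZ`. -/
def area₂ (X Y Z : ℂ) : ℝ :=
  X.re * Y.im - X.im * Y.re + (Y.re * Z.im - Y.im * Z.re) + (Z.re * X.im - Z.im * X.re)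

/-- The automorphy factor of the product of the three chord involutions. -/
noncomputable def factor (X Y Z v : ℂ) : ℂ := coeffA X Y Z + coeffB X Y Z * conj v

/-- Half the trace of the product of involutions: the link between its conjugacy type and the area.
-/
theorem coeffA_re (X Y Z : ℂ) : (coeffA X Y Z).re = area₂ X Y Z := by
  simp [coeffA, area₂]; ring

/-- Multiplicativity of the determinant: the involution at `X` has matrix `i(-1 X; -X̄ 1)` of
determinant `1 - |X|²`, and their product is `(A B; B̄ Ā)`. -/
theorem normSq_coeff (X Y Z : ℂ) :
    Complex.normSq (coeffA X Y Z) - Complex.normSq (coeffB X Y Z) =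
      (1 - ‖X‖ ^ 2) * (1 - ‖Y‖ ^ 2) * (1 - ‖Z‖ ^ 2) := by
  simp only [Complex.sq_norm, Complex.normSq_apply]
  simp [coeffA, coeffB]
  ring

theorem ChordEq.conj_mul {X : ℂ} {v w : Circle} (h : ChordEq X v w) :
    conj (w : ℂ) * (1 - X * conj (v : ℂ)) = conj X - conj (v : ℂ) := by
  have := congrArg conj h
  simp only [map_add, map_mul, Complex.conj_conj] at this
  linear_combination this

/-- On the circle the involution is `w = -v c / c̄` with `c = 1 - X v̄`; this is what makes the
factors multiply along consecutive chords. -/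
theorem ChordEq.mul_conj {X : ℂ} {v w : Circle} (h : ChordEq X v w) :
    (w : ℂ) * conj (1 - X * conj (v : ℂ)) = -v * (1 - X * conj (v : ℂ)) := by
  have hv := coe_mul_conj v
  unfold ChordEq at h
  simp only [map_sub, map_one, map_mul, Complex.conj_conj]
  linear_combination h - X * hv

theorem factor_eq_mul {X Y Z : ℂ} {v v' : Circle} (h : ChordEq X v v') :
    factor X Y Z v = Complex.I * (1 - X * conj (v : ℂ)) *
      (1 - Z * conj Y + (Z - Y) * conj (v' : ℂ)) := by
  have h1 := h.conj_mul
  unfold factor coeffA coeffB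
  linear_combination (-Complex.I * (Z - Y)) * h1

theorem factor_eq_prod {X Y Z : ℂ} {v v' v'' : Circle} (h : ChordEq X v v')
    (h' : ChordEq Y v' v'') :
    factor X Y Z v = Complex.I * (1 - X * conj (v : ℂ)) * (1 - Y * conj (v' : ℂ)) *
      (1 - Z * conj (v'' : ℂ)) := by
  have h1 := h'.conj_mul
  rw [factor_eq_mul h]
  linear_combination (Complex.I * (1 - X * conj (v : ℂ)) * Z) * h1

/-- Three applications of `ChordEq.mul_conj`, the three signs being absorbed by conjugating `I`. The
angle from `v` to `v'''` is therefore twice the argument of the factor. -/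
theorem mul_conj_factor {X Y Z : ℂ} {v v' v'' v''' : Circle} (h : ChordEq X v v')
    (h' : ChordEq Y v' v'') (h'' : ChordEq Z v'' v''') :
    (v''' : ℂ) * conj (factor X Y Z v) = v * factor X Y Z v := by
  have e1 := h.mul_conj
  have e2 := h'.mul_conj
  have e3 := h''.mul_conj
  rw [factor_eq_prod h h', map_mul, map_mul, map_mul, Complex.conj_I]
  generalize 1 - X * conj (v : ℂ) = c1 at *
  generalize 1 - Y * conj (v' : ℂ) = c2 at *
  generalize 1 - Z * conj (v'' : ℂ) = c3 at *
  linear_combination (-Complex.I * conj c1 * conj c2) * e3 +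
    (Complex.I * conj c1 * c3) * e2 - (Complex.I * c2 * c3) * e1

theorem factor_ne_zero {X Y Z : ℂ} (hX : ‖X‖ < 1) (hY : ‖Y‖ < 1) (hZ : ‖Z‖ < 1)
    {v v' v'' : Circle} (h : ChordEq X v v') (h' : ChordEq Y v' v'') :
    factor X Y Z v ≠ 0 := by
  have key : ∀ {X : ℂ} (_ : ‖X‖ < 1) (v : Circle), 1 - X * conj (v : ℂ) ≠ 0 := by
    intro X hX v h0
    apply one_sub_conj_mul_ne_zero hX v
    have := congrArg conj h0
    simpa using this
  rw [factor_eq_prod h h']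
  exact mul_ne_zero (mul_ne_zero (mul_ne_zero Complex.I_ne_zero (key hX v)) (key hY v'))
    (key hZ v'')

/-! ### The product of three chord involutions in the angular coordinate -/

theorem circleTurn_add_coe (x t : ℝ) :
    (circleTurn (x + t) : ℂ) = circleTurn x * circleTurn t := by
  rw [circleTurn, mul_add, Circle.exp_add]; rfl

theorem circleTurn_coe (x : ℝ) : (circleTurn x : ℂ) =
    Real.cos (2 * Real.pi * x) + Real.sin (2 * Real.pi * x) * Complex.I := by
  rw [circleTurn, Circle.coe_exp, Complex.exp_mul_I]; push_cast; rfl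

theorem circleTurn_half_coe (x : ℝ) : (circleTurn (x / 2) : ℂ) =
    Real.cos (Real.pi * x) + Real.sin (Real.pi * x) * Complex.I := by
  rw [circleTurn_coe, show 2 * Real.pi * (x / 2) = Real.pi * x by ring]

theorem conj_circleTurn (x : ℝ) : conj (circleTurn x : ℂ) = circleTurn (-x) := by
  have h := coe_mul_conj (circleTurn x)
  have h2 : (circleTurn x : ℂ) * circleTurn (-x) = 1 := by
    rw [← circleTurn_add_coe, add_neg_cancel, circleTurn]; simp
  exact mul_left_cancel₀ (Circle.coe_ne_zero _) (h.trans h2.symm)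

theorem one_sub_circleTurn (t : ℝ) : 1 - (circleTurn t : ℂ) =
    -2 * Complex.I * Real.sin (Real.pi * t) * circleTurn (t / 2) := by
  have h1 : (circleTurn t : ℂ) = circleTurn (t / 2) * circleTurn (t / 2) := by
    rw [← circleTurn_add_coe]; norm_num
  have h2 : (Real.sin (Real.pi * t) : ℂ) ^ 2 + (Real.cos (Real.pi * t) : ℂ) ^ 2 = 1 := by
    exact_mod_cast Real.sin_sq_add_cos_sq _
  rw [h1, circleTurn_half_coe]
  linear_combination (-1 : ℂ) * h2 +
    (Real.sin (Real.pi * t) : ℂ) ^ 2 * Complex.I_sq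

/-- The automorphy factor at a triangle of chords is positive. -/
theorem factor_pos {X Y Z : ℂ} {x y z : ℝ} (hxy : x < y) (hyz : y < z) (hzx : z < x + 1)
    (hX : OnChord X (circleTurn x) (circleTurn y)) (hY : OnChord Y (circleTurn y) (circleTurn z))
    (hZ : OnChord Z (circleTurn z) (circleTurn x)) :
    ∃ r : ℝ, 0 < r ∧ factor X Y Z (circleTurn x) = r := by
  have key : ∀ {X : ℂ} {x y s : ℝ}, X = circleTurn x + s * (circleTurn y - circleTurn x) →
      1 - X * conj (circleTurn x : ℂ) =
        s * (-2 * Complex.I * Real.sin (Real.pi * (y - x)) * circleTurn ((y - x) / 2)) := by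
    intro X x y s h
    rw [← one_sub_circleTurn, h, sub_eq_add_neg y x, circleTurn_add_coe y, ← conj_circleTurn]
    linear_combination (s - 1 : ℂ) * coe_mul_conj (circleTurn x)
  have hfac := factor_eq_prod hX.chordEq hY.chordEq (Z := Z)
  obtain ⟨s₁, hs₁, e₁⟩ := hX
  obtain ⟨s₂, hs₂, e₂⟩ := hY
  obtain ⟨s₃, hs₃, e₃⟩ := hZ
  -- Ending the third chord at `x + 1` makes all three angular steps lie between 0 and 1, so that
  -- their sines are positive.
  rw [← circleTurn_add_one x] at e₃
  rw [key e₁, key e₂, key e₃] at hfac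
  -- The steps add up to one full turn, so the half-angle phases multiply to a half turn; with `I *
  -- (-2I)³ = -8` the product is positive.
  have hprod : (circleTurn ((y - x) / 2) : ℂ) * circleTurn ((z - y) / 2) *
      circleTurn ((x + 1 - z) / 2) = -1 := by
    rw [← circleTurn_add_coe, ← circleTurn_add_coe,
      show (y - x) / 2 + (z - y) / 2 + (x + 1 - z) / 2 = 1 / 2 by ring, circleTurn_half_coe]
    simp
  have hpi := Real.pi_pos
  have hsin : ∀ t : ℝ, 0 < t → t < 1 → 0 < Real.sin (Real.pi * t) := fun t h1 h2 =>
    Real.sin_pos_of_pos_of_lt_pi (by positivity) (by nlinarith)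
  have p1 := hsin (y - x) (by linarith) (by linarith)
  have p2 := hsin (z - y) (by linarith) (by linarith)
  have p3 := hsin (x + 1 - z) (by linarith) (by linarith)
  have q1 := hs₁.1
  have q2 := hs₂.1
  have q3 := hs₃.1
  refine ⟨8 * (s₁ * s₂ * s₃) * (Real.sin (Real.pi * (y - x)) * Real.sin (Real.pi * (z - y)) *
    Real.sin (Real.pi * (x + 1 - z))), by positivity, ?_⟩
  rw [hfac]
  push_cast
  generalize (Complex.sin (Real.pi * (y - x))) = S1 at *
  generalize (Complex.sin (Real.pi * (z - y))) = S2 at *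
  generalize (Complex.sin (Real.pi * (x + 1 - z))) = S3 at *
  generalize (circleTurn ((y - x) / 2) : ℂ) = C1 at *
  generalize (circleTurn ((z - y) / 2) : ℂ) = C2 at *
  generalize (circleTurn ((x + 1 - z) / 2) : ℂ) = C3 at *
  linear_combination (-8 * Complex.I ^ 4 * s₁ * s₂ * s₃ * S1 * S2 * S3) * hprod +
    (8 * s₁ * s₂ * s₃ * S1 * S2 * S3 * (Complex.I ^ 2 - 1)) * Complex.I_sq

/-- At the periodic point `B x̄ = r - A`, so the factor at `y` is `A + (r - A)` times a phase
depending only on `y - x`; half-angle formulas give the product form. -/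
theorem factor_im {X Y Z : ℂ} {x : ℝ} (r : ℝ) (h : factor X Y Z (circleTurn x) = r) (y : ℝ) :
    (factor X Y Z (circleTurn y)).im = 2 * Real.sin (Real.pi * (y - x)) *
      ((coeffA X Y Z).im * Real.sin (Real.pi * (y - x)) -
        (r - area₂ X Y Z) * Real.cos (Real.pi * (y - x))) := by
  have h1 : factor X Y Z (circleTurn y) =
      coeffA X Y Z + (r - coeffA X Y Z) * conj (circleTurn (y - x) : ℂ) := by
    have h2 : (circleTurn y : ℂ) = circleTurn x * circleTurn (y - x) := by
      rw [← circleTurn_add_coe]; congr 2; ring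
    rw [← h, factor, factor, h2, map_mul]; ring
  have hsq := Real.sin_sq_add_cos_sq (Real.pi * (y - x))
  rw [h1, circleTurn_coe, show 2 * Real.pi * (y - x) = 2 * (Real.pi * (y - x)) by ring,
    Real.cos_two_mul, Real.sin_two_mul, ← coeffA_re]
  simp only [Complex.add_im, Complex.mul_im, Complex.sub_re, Complex.sub_im, Complex.ofReal_re,
    Complex.ofReal_im, map_add, map_mul, Complex.conj_ofReal, Complex.conj_I, Complex.add_re,
    Complex.mul_re, Complex.neg_re, Complex.neg_im, Complex.I_re, Complex.I_im]
  linear_combination (-2 * (coeffA X Y Z).im) * hsq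

/-- `r` is the eigenvalue of `(A B; B̄ Ā)` on the vector `(v, 1)`, and this is the characteristic
equation; it comes from `|r - A| = |B|`. -/
theorem factor_quadratic {X Y Z : ℂ} {x r : ℝ} (h : factor X Y Z (circleTurn x) = r) :
    r ^ 2 - 2 * area₂ X Y Z * r + (1 - ‖X‖ ^ 2) * (1 - ‖Y‖ ^ 2) * (1 - ‖Z‖ ^ 2) = 0 := by
  have h1 : Complex.normSq (r - coeffA X Y Z) = Complex.normSq (coeffB X Y Z) := by
    rw [← h, factor, add_sub_cancel_left, map_mul, Complex.normSq_conj, Circle.normSq_coe,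
      mul_one]
  have h2 := normSq_coeff X Y Z
  rw [← h1, ← coeffA_re] at *
  simp only [Complex.normSq_apply, Complex.sub_re, Complex.sub_im, Complex.ofReal_re,
    Complex.ofReal_im] at h2
  linear_combination -h2

/-- The computation behind `factor_im_pos`, with `p` and `q` half-angle phases. The expression
splits into a term `4a²(1 - s₂)(2s₃a² + 2(1 - s₃)(Im u)²)`, `u = p̄q̄`, and a nonnegative term
`8a²g²s₂s₃`. -/
theorem im_pos_aux {p q : ℂ} {a g ca cg s₂ s₃ : ℝ} (hp : p = ca + a * Complex.I)
    (hq : q = cg + g * Complex.I) (hp1 : p * conj p = 1) (hq1 : q * conj q = 1) (ha : 0 < a)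
    (hs₂ : s₂ ∈ Set.Ioo (0 : ℝ) 1) (hs₃ : s₃ ∈ Set.Ioo (0 : ℝ) 1) :
    0 < (Complex.I * (1 - conj p ^ 2) * (((1 - s₂) * (1 - p ^ 2) + s₂ * (1 - conj q ^ 2)) +
      (s₃ + (1 - s₃) * conj q ^ 2) *
        ((1 - s₂) * (1 - conj p ^ 2) + s₂ * (1 - q ^ 2)))).im := by
  have hpa : p - conj p = 2 * Complex.I * a := by
    rw [hp]; simp only [map_add, map_mul, Complex.conj_ofReal, Complex.conj_I]; ring
  have hqg : q - conj q = 2 * Complex.I * g := by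
    rw [hq]; simp only [map_add, map_mul, Complex.conj_ofReal, Complex.conj_I]; ring
  have h1 : 1 - conj p ^ 2 = 2 * Complex.I * a * conj p := by
    linear_combination -hp1 + conj p * hpa
  have h2 : 1 - p ^ 2 = -2 * Complex.I * a * p := by
    linear_combination -hp1 - p * hpa
  have h3 : 1 - conj q ^ 2 = 2 * Complex.I * g * conj q := by
    linear_combination -hq1 + conj q * hqg
  have h4 : 1 - q ^ 2 = -2 * Complex.I * g * q := by
    linear_combination -hq1 - q * hqg
  have hmain : Complex.I * (1 - conj p ^ 2) *
      (((1 - s₂) * (1 - p ^ 2) + s₂ * (1 - conj q ^ 2)) +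
      (s₃ + (1 - s₃) * conj q ^ 2) *
        ((1 - s₂) * (1 - conj p ^ 2) + s₂ * (1 - q ^ 2))) =
      ((4 * a ^ 2 * (1 - s₂) : ℝ) : ℂ) *
        (Complex.I * (1 - s₃ * conj p ^ 2 - (1 - s₃) * (conj p * conj q) ^ 2)) -
        ((8 * a * g ^ 2 * s₂ * s₃ : ℝ) : ℂ) * conj p := by
    rw [h1, h2, h3, h4]
    push_cast
    generalize conj p = p' at *
    generalize conj q = q' at *
    linear_combination (2 * a * p' * ((1 - s₂) * (-2 * Complex.I * a * p) +
        s₂ * (2 * Complex.I * g * q') + (s₃ + (1 - s₃) * q' ^ 2) *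
        ((1 - s₂) * (2 * Complex.I * a * p') + s₂ * (-2 * Complex.I * g * q))) +
        8 * a * g ^ 2 * s₂ * s₃ * p') * Complex.I_sq +
      4 * Complex.I * a ^ 2 * (1 - s₂) * hp1 +
      4 * Complex.I * a * g * s₂ * (1 - s₃) * p' * q' * hq1 +
      4 * Complex.I * a * g * s₂ * s₃ * p' * hqg
  have hu : Complex.normSq (conj p * conj q) = 1 := by
    rw [Complex.mul_conj] at hp1 hq1
    rw [map_mul, Complex.normSq_conj, Complex.normSq_conj]
    have h5 : Complex.normSq p = 1 := by exact_mod_cast hp1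
    have h6 : Complex.normSq q = 1 := by exact_mod_cast hq1
    rw [h5, h6, one_mul]
  have hp2 : (conj p).re ^ 2 + (conj p).im ^ 2 = 1 := by
    rw [Complex.mul_conj] at hp1
    have h5 : Complex.normSq p = 1 := by exact_mod_cast hp1
    rw [← Complex.normSq_conj, Complex.normSq_apply] at h5
    linarith
  have him : (conj p).im = -a := by rw [hp]; simp
  rw [hmain]
  generalize conj p * conj q = u at *
  generalize conj p = p' at *
  rw [Complex.normSq_apply] at hu
  have e : (((4 * a ^ 2 * (1 - s₂) : ℝ) : ℂ) *
        (Complex.I * (1 - s₃ * p' ^ 2 - (1 - s₃) * u ^ 2)) -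
        ((8 * a * g ^ 2 * s₂ * s₃ : ℝ) : ℂ) * p').im = 4 * a ^ 2 * (1 - s₂) *
        (1 - s₃ * (p'.re ^ 2 - p'.im ^ 2) - (1 - s₃) * (u.re ^ 2 - u.im ^ 2)) -
        8 * a * g ^ 2 * s₂ * s₃ * p'.im := by
    rw [Complex.sub_im, Complex.im_ofReal_mul, Complex.im_ofReal_mul]
    simp only [pow_two, Complex.mul_im, Complex.mul_re, Complex.sub_re, Complex.sub_im,
      Complex.ofReal_re, Complex.ofReal_im, Complex.one_re, Complex.one_im, Complex.I_re,
      Complex.I_im]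
    ring
  rw [e, him]
  rw [him] at hp2
  obtain ⟨h5, h6⟩ := hs₂
  obtain ⟨h7, h8⟩ := hs₃
  have h9 : 0 < 1 - s₃ * (p'.re ^ 2 - (-a) ^ 2) - (1 - s₃) * (u.re ^ 2 - u.im ^ 2) := by
    have : 1 - s₃ * (p'.re ^ 2 - (-a) ^ 2) - (1 - s₃) * (u.re ^ 2 - u.im ^ 2) =
        2 * s₃ * a ^ 2 + 2 * (1 - s₃) * u.im ^ 2 := by
      linear_combination (-s₃) * hp2 - (1 - s₃) * hu
    rw [this]
    have h10 : 0 ≤ 1 - s₃ := by linarith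
    positivity
  have h10 : 0 < 1 - s₂ := by linarith
  have h11 : 0 ≤ 8 * a * g ^ 2 * s₂ * s₃ * a := by positivity
  have h12 : 0 < 4 * a ^ 2 * (1 - s₂) *
      (1 - s₃ * (p'.re ^ 2 - (-a) ^ 2) - (1 - s₃) * (u.re ^ 2 - u.im ^ 2)) := by positivity
  linarith

/-- The product of the three chord involutions of a triangle of chords moves the second corner
forward. -/
theorem factor_im_pos {X Y Z : ℂ} {x y z : ℝ} (hxy : x < y) (hyx : y < x + 1)
    (hX : OnChord X (circleTurn x) (circleTurn y)) (hY : OnChord Y (circleTurn y) (circleTurn z))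
    (hZ : OnChord Z (circleTurn z) (circleTurn x)) :
    0 < (factor X Y Z (circleTurn y)).im := by
  have hfac := factor_eq_mul (Y := Y) (Z := Z) hX.chordEq.symm
  obtain ⟨s₁, hs₁, rfl⟩ := hX
  obtain ⟨s₂, hs₂, rfl⟩ := hY
  obtain ⟨s₃, hs₃, rfl⟩ := hZ
  have hpi := Real.pi_pos
  have ha : 0 < Real.sin (Real.pi * (y - x)) :=
    Real.sin_pos_of_pos_of_lt_pi (mul_pos hpi (by linarith)) (by nlinarith)
  have hp1 := coe_mul_conj (circleTurn ((y - x) / 2))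
  have hq1 := coe_mul_conj (circleTurn ((x - z) / 2))
  have key := im_pos_aux (circleTurn_half_coe (y - x)) (circleTurn_half_coe (x - z)) hp1 hq1
    ha hs₂ hs₃
  -- Relative to the first corner the other two are `p²` and `q̄²`; after the positive factor `1 -
  -- s₁` is split off, `im_pos_aux` applies.
  have hy : (circleTurn y : ℂ) = circleTurn x * circleTurn ((y - x) / 2) ^ 2 := by
    rw [pow_two, ← circleTurn_add_coe, ← circleTurn_add_coe]; congr 2; ring
  have hz : (circleTurn z : ℂ) = circleTurn x * conj (circleTurn ((x - z) / 2) : ℂ) ^ 2 := by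
    rw [conj_circleTurn, pow_two, ← circleTurn_add_coe, ← circleTurn_add_coe]; congr 2; ring
  have hu := coe_mul_conj (circleTurn x)
  rw [hy, hz] at hfac ⊢
  generalize (circleTurn ((y - x) / 2) : ℂ) = p at *
  generalize (circleTurn ((x - z) / 2) : ℂ) = q at *
  generalize (circleTurn x : ℂ) = u at *
  have e : ∀ f : ℂ, f = ((1 - s₁ : ℝ) : ℂ) * (Complex.I * (1 - conj p ^ 2) *
      (((1 - s₂) * (1 - p ^ 2) + s₂ * (1 - conj q ^ 2)) +
      (s₃ + (1 - s₃) * conj q ^ 2) *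
        ((1 - s₂) * (1 - conj p ^ 2) + s₂ * (1 - q ^ 2)))) → 0 < f.im := by
    rintro f rfl
    rw [Complex.im_ofReal_mul]
    exact mul_pos (by linarith [hs₁.2]) key
  refine e _ (hfac.trans ?_)
  simp only [map_add, map_mul, map_sub, map_pow, Complex.conj_conj, Complex.conj_ofReal,
    Complex.ofReal_sub, Complex.ofReal_one]
  generalize conj p = p' at *
  generalize conj q = q' at *
  generalize conj u = u' at *
  have hpp : u * p ^ 2 * (u' * p' ^ 2) = 1 := by
    linear_combination (p ^ 2 * p' ^ 2) * hu + (p * p' + 1) * hp1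
  have e1 : 1 - (u + s₁ * (u * p ^ 2 - u)) * (u' * p' ^ 2) = (1 - s₁) * (1 - p' ^ 2) := by
    linear_combination (-s₁ : ℂ) * hpp - ((1 - s₁ : ℂ) * p' ^ 2) * hu
  rw [e1]
  have e2 : (1 - (u * q' ^ 2 + s₃ * (u - u * q' ^ 2)) *
        (u' * p' ^ 2 + s₂ * (u' * q ^ 2 - u' * p' ^ 2)) +
      (u * q' ^ 2 + s₃ * (u - u * q' ^ 2) - (u * p ^ 2 + s₂ * (u * q' ^ 2 - u * p ^ 2))) * u') =
      (((1 - s₂) * (1 - p ^ 2) + s₂ * (1 - q' ^ 2)) +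
      (s₃ + (1 - s₃) * q' ^ 2) * ((1 - s₂) * (1 - p' ^ 2) + s₂ * (1 - q ^ 2))) := by
    linear_combination (-(q' ^ 2 + s₃ * (1 - q' ^ 2)) *
        (p' ^ 2 + s₂ * (q ^ 2 - p' ^ 2)) +
      (q' ^ 2 + s₃ * (1 - q' ^ 2) - (p ^ 2 + s₂ * (q' ^ 2 - p ^ 2)))) * hu
  rw [e2]
  ring

/-! ### The return map near a periodic orbit -/

section orbit

variable {F : CircleDeg1Lift}

/-- The orbit of `x` has period three and spans a triangle with `X, Y, Z` on its sides. -/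
def IsCircumscribed (F : CircleDeg1Lift) (X Y Z : ℂ) (x : ℝ) : Prop :=
  ret F x = x ∧ OnChord X (circleTurn x) (circleTurn (F x)) ∧
    OnChord Y (circleTurn (F x)) (circleTurn (F (F x))) ∧
    OnChord Z (circleTurn (F (F x))) (circleTurn x)

theorem circleTurn_map_map_map {x : ℝ} (hx : ret F x = x) :
    circleTurn (F (F (F x))) = circleTurn x := by
  rw [map_map_map_of_fixed hx, circleTurn_add_one]

theorem IsCircumscribed.rotate {X Y Z : ℂ} {x : ℝ} (h : IsCircumscribed F X Y Z x) :
    IsCircumscribed F Y Z X (F x) := by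
  obtain ⟨hx, h1, h2, h3⟩ := h
  refine ⟨ret_fixed_map hx, h2, ?_, ?_⟩ <;> rw [circleTurn_map_map_map hx] <;> assumption

theorem IsCircumscribed.factor_pos {X Y Z : ℂ} {x : ℝ} (h : IsCircumscribed F X Y Z x)
    (h1 : ∀ x, x < F x) : ∃ r : ℝ, 0 < r ∧ factor X Y Z (circleTurn x) = r := by
  obtain ⟨a1, a2, a3⟩ := map_lt_add_one_of_fixed h1 h.1
  exact KleinTriangle.factor_pos a1 a2 a3 h.2.1 h.2.2.1 h.2.2.2

/-- The positive eigenvalue `r` satisfies `2 · area · r = r² + D` with `D > 0`. -/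
theorem IsCircumscribed.area_pos {X Y Z : ℂ} {x : ℝ} (h : IsCircumscribed F X Y Z x)
    (h1 : ∀ x, x < F x) (hX : ‖X‖ < 1) (hY : ‖Y‖ < 1) (hZ : ‖Z‖ < 1) : 0 < area₂ X Y Z := by
  obtain ⟨r, hr, hf⟩ := h.factor_pos h1
  have hq := factor_quadratic hf
  have key : ∀ {X : ℂ}, ‖X‖ < 1 → 0 < 1 - ‖X‖ ^ 2 := fun hX => by
    nlinarith [norm_nonneg ‹ℂ›]
  have := mul_pos (mul_pos (key hX) (key hY)) (key hZ)
  by_contra! hle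
  nlinarith

theorem continuous_factor (X Y Z : ℂ) : Continuous fun y => factor X Y Z (circleTurn y) := by
  unfold factor
  have := circleTurn_continuous
  fun_prop

/-- With `W` the factor, `W² = |W|² exp(2πi(ret F y - y))`. Its imaginary part is `2 Re W Im W`,
where `Re W > 0` near `x`, and the displacement is below half a turn, so it has the sign of its
sine. -/
theorem eventually_sign_ret (hF : Continuous F) {X Y Z : ℂ} (hX : ‖X‖ < 1) (hY : ‖Y‖ < 1)
    (hZ : ‖Z‖ < 1) {x : ℝ} (hx : ret F x = x) (hpos : 0 < (factor X Y Z (circleTurn x)).re)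
    (hev : ∀ᶠ y in 𝓝 x, ChordEq X (circleTurn y) (circleTurn (F y)) ∧
      ChordEq Y (circleTurn (F y)) (circleTurn (F (F y))) ∧
      ChordEq Z (circleTurn (F (F y))) (circleTurn (F (F (F y))))) :
    ∀ᶠ y in 𝓝 x, (0 < (factor X Y Z (circleTurn y)).im → y < ret F y) ∧
      ((factor X Y Z (circleTurn y)).im < 0 → ret F y < y) := by
  have hre : ∀ᶠ y in 𝓝 x, 0 < (factor X Y Z (circleTurn y)).re :=
    (Complex.continuous_re.comp (continuous_factor X Y Z)).continuousAt.eventually_const_lt hpos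
  have hcont : Continuous fun y => ret F y - y := (ret_continuous hF).sub continuous_id
  have hlt : ∀ᶠ y in 𝓝 x, ret F y - y < 1 / 2 :=
    hcont.continuousAt.eventually_lt_const (by simp [hx])
  have hgt : ∀ᶠ y in 𝓝 x, -(1 / 2) < ret F y - y :=
    hcont.continuousAt.eventually_const_lt (by simp [hx])
  filter_upwards [hre, hlt, hgt, hev] with y h1 h2 h3 ⟨c1, c2, c3⟩
  have hmul := mul_conj_factor c1 c2 c3
  have hne := factor_ne_zero hX hY hZ c1 c2
  set W := factor X Y Z (circleTurn y)
  have e1 : (circleTurn (F (F (F y))) : ℂ) = circleTurn y * circleTurn (ret F y - y) := by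
    rw [← circleTurn_add_coe, ← circleTurn_add_one (y + (ret F y - y))]
    congr 2; rw [ret]; ring
  have e2 : (circleTurn (ret F y - y) : ℂ) * (Complex.normSq W : ℂ) = W ^ 2 := by
    rw [e1, mul_assoc] at hmul
    have := mul_left_cancel₀ (Circle.coe_ne_zero _) hmul
    rw [← Complex.mul_conj]; linear_combination W * this
  have e3 := congrArg Complex.im e2
  rw [Complex.im_mul_ofReal, pow_two, Complex.mul_im, circleTurn_coe] at e3
  simp only [Complex.add_im, Complex.ofReal_im, zero_add, Complex.im_ofReal_mul, Complex.I_im,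
    mul_one] at e3
  have hn := Complex.normSq_pos.2 hne
  have hpi := Real.pi_pos
  constructor
  · intro him
    by_contra! hle
    have : Real.sin (2 * Real.pi * (ret F y - y)) ≤ 0 :=
      Real.sin_nonpos_of_nonpos_of_neg_pi_le
        (mul_nonpos_of_nonneg_of_nonpos (by positivity) (by linarith)) (by nlinarith)
    nlinarith [mul_pos h1 him]
  · intro him
    by_contra! hle
    have : 0 ≤ Real.sin (2 * Real.pi * (ret F y - y)) :=
      Real.sin_nonneg_of_nonneg_of_le_pi (mul_nonneg (by positivity) (by linarith))
        (by nlinarith)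
    nlinarith [mul_neg_of_pos_of_neg h1 him]

variable {P Q R : ℂ}

/-- Not satisfying the chord equation is an open condition. The finitely many vertices off the line
at `x` stay off it nearby, leaving only `X`. -/
theorem eventually_chordEq (hF : Continuous F)
    (hv : ∀ x, ∃ X ∈ ({P, Q, R} : Set ℂ), OnChord X (circleTurn x) (circleTurn (F x)))
    {X : ℂ} {x : ℝ} (h : ∀ T ∈ ({P, Q, R} : Set ℂ), T ≠ X →
      ¬ ChordEq T (circleTurn x) (circleTurn (F x))) :
    ∀ᶠ y in 𝓝 x, ChordEq X (circleTurn y) (circleTurn (F y)) := by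
  have hopen : ∀ T ∈ ({P, Q, R} : Set ℂ), T ≠ X →
      ∀ᶠ y in 𝓝 x, ¬ ChordEq T (circleTurn y) (circleTurn (F y)) := by
    intro T hT hTX
    have hc := circleTurn_continuous
    have hcl : IsClosed {y | ChordEq T (circleTurn y) (circleTurn (F y))} := by
      unfold ChordEq
      exact isClosed_eq (by fun_prop) (by fun_prop)
    exact hcl.isOpen_compl.mem_nhds (h T hT hTX)
  have hall : ∀ᶠ y in 𝓝 x, ∀ T ∈ ({P, Q, R} : Set ℂ), T ≠ X →
      ¬ ChordEq T (circleTurn y) (circleTurn (F y)) := by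
    rw [eventually_all_finite (by simp)]
    intro T hT
    by_cases hTX : T = X
    · simp [hTX]
    · filter_upwards [hopen T hT hTX] with y hy _ using hy
  filter_upwards [hall] with y hy
  obtain ⟨T, hT, hTc⟩ := hv y
  by_cases hTX : T = X
  · rw [← hTX]; exact hTc.chordEq
  · exact absurd hTc.chordEq (hy T hT hTX)

theorem mem_triple_cases {α : Type*} {a b c x y z : α} (hx : x ∈ ({a, b, c} : Set α))
    (hy : y ∈ ({a, b, c} : Set α)) (hz : z ∈ ({a, b, c} : Set α)) (hxy : x ≠ y) (hyz : y ≠ z)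
    (hzx : z ≠ x) :
    (x = a ∧ y = b ∧ z = c) ∨ (x = b ∧ y = c ∧ z = a) ∨ (x = c ∧ y = a ∧ z = b) ∨
      (x = a ∧ y = c ∧ z = b) ∨ (x = c ∧ y = b ∧ z = a) ∨ (x = b ∧ y = a ∧ z = c) := by
  simp only [Set.mem_insert_iff, Set.mem_singleton_iff] at hx hy hz
  grind

/-- If two sides passed through the same vertex, uniqueness of the second end of a chord would
identify two points of the orbit. -/
theorem exists_isCircumscribed (h1 : ∀ x, x < F x) (hP : ‖P‖ < 1) (hQ : ‖Q‖ < 1) (hR : ‖R‖ < 1)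
    (hv : ∀ x, ∃ X ∈ ({P, Q, R} : Set ℂ), OnChord X (circleTurn x) (circleTurn (F x)))
    {x : ℝ} (hx : ret F x = x) : ∃ X Y Z, X ∈ ({P, Q, R} : Set ℂ) ∧ Y ∈ ({P, Q, R} : Set ℂ) ∧
      Z ∈ ({P, Q, R} : Set ℂ) ∧ X ≠ Y ∧ Y ≠ Z ∧ Z ≠ X ∧ IsCircumscribed F X Y Z x := by
  have hn : ∀ X ∈ ({P, Q, R} : Set ℂ), ‖X‖ < 1 := by rintro X (rfl | rfl | rfl) <;> assumption
  obtain ⟨X, hX, cX⟩ := hv x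
  obtain ⟨Y, hY, cY⟩ := hv (F x)
  obtain ⟨Z, hZ, cZ⟩ := hv (F (F x))
  have e := circleTurn_map_map_map hx
  rw [e] at cZ
  obtain ⟨a1, a2, a3⟩ := map_lt_add_one_of_fixed h1 hx
  have ne : ∀ {p q : ℝ}, p < q → q < p + 1 → (circleTurn p : ℂ) ≠ circleTurn q :=
    fun h h' he => circleTurn_ne h h' (Circle.ext he)
  refine ⟨X, Y, Z, hX, hY, hZ, ?_, ?_, ?_, hx, cX, cY, cZ⟩
  · rintro rfl
    exact ne (a1.trans a2) a3 (cX.chordEq.symm.unique (hn _ hX) cY.chordEq)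
  · rintro rfl
    exact (ne a1 (by linarith)).symm (cY.chordEq.symm.unique (hn _ hY) cZ.chordEq)
  · rintro rfl
    exact (ne a2 (by linarith)).symm (cZ.chordEq.symm.unique (hn _ hX) cX.chordEq)

/-- Near a periodic orbit, the return map is a product of three chord involutions. -/
theorem IsCircumscribed.eventually_chordEq (hF : Continuous F) (h1 : ∀ x, x < F x)
    (hv : ∀ x, ∃ X ∈ ({P, Q, R} : Set ℂ), OnChord X (circleTurn x) (circleTurn (F x)))
    {X Y Z : ℂ} {x : ℝ} (hsub : ∀ T ∈ ({P, Q, R} : Set ℂ), T = X ∨ T = Y ∨ T = Z)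
    (hX : ‖X‖ < 1) (hY : ‖Y‖ < 1) (hZ : ‖Z‖ < 1) (h : IsCircumscribed F X Y Z x) :
    ∀ᶠ y in 𝓝 x, ChordEq X (circleTurn y) (circleTurn (F y)) ∧
      ChordEq Y (circleTurn (F y)) (circleTurn (F (F y))) ∧
      ChordEq Z (circleTurn (F (F y))) (circleTurn (F (F (F y)))) := by
  have first : ∀ {X Y Z : ℂ} {x : ℝ}, (∀ T ∈ ({P, Q, R} : Set ℂ), T = X ∨ T = Y ∨ T = Z) →
      ‖Y‖ < 1 → ‖Z‖ < 1 → IsCircumscribed F X Y Z x →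
      ∀ᶠ y in 𝓝 x, ChordEq X (circleTurn y) (circleTurn (F y)) := by
    rintro X Y Z x hsub hY hZ ⟨hx, cX, cY, cZ⟩
    obtain ⟨a1, a2, a3⟩ := map_lt_add_one_of_fixed h1 hx
    have ne : ∀ {p q : ℝ}, p < q → q < p + 1 → (circleTurn p : ℂ) ≠ circleTurn q :=
      fun h h' he => circleTurn_ne h h' (Circle.ext he)
    refine KleinTriangle.eventually_chordEq hF hv fun T hT hTX hc => ?_
    rcases hsub T hT with rfl | rfl | rfl
    · exact hTX rfl
    · exact ne (a1.trans a2) a3 (hc.symm.unique hY cY.chordEq)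
    · exact (ne a2 (by linarith)).symm (cZ.chordEq.symm.unique hZ hc)
  have f1 := first hsub hY hZ h
  have f2 := first (fun T hT => by have := hsub T hT; tauto) hZ hX h.rotate
  have f3 := first (fun T hT => by have := hsub T hT; tauto) hX hY h.rotate.rotate
  have t2 : Tendsto (fun y => F y) (𝓝 x) (𝓝 (F x)) := hF.tendsto x
  have t3 : Tendsto (fun y => F (F y)) (𝓝 x) (𝓝 (F (F x))) := (hF.comp hF).tendsto x
  filter_upwards [f1, t2.eventually f2, t3.eventually f3] with y g1 g2 g3
  exact ⟨g1, g2, g3⟩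

/-- The imaginary part of the automorphy factor in terms of the angle from a periodic point. -/
theorem IsCircumscribed.factor_form (h1 : ∀ x, x < F x) {X Y Z : ℂ} {x : ℝ}
    (h : IsCircumscribed F X Y Z x) : ∃ c k : ℝ,
      k ^ 2 = area₂ X Y Z ^ 2 - (1 - ‖X‖ ^ 2) * (1 - ‖Y‖ ^ 2) * (1 - ‖Z‖ ^ 2) ∧
      (k = 0 → 0 < c) ∧ ∀ y, (factor X Y Z (circleTurn y)).im =
        2 * (Real.sin (Real.pi * (y - x)) * (c * Real.sin (Real.pi * (y - x)) -
          k * Real.cos (Real.pi * (y - x)))) := by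
  obtain ⟨r, hr, hf⟩ := h.factor_pos h1
  refine ⟨(coeffA X Y Z).im, r - area₂ X Y Z, ?_, ?_, fun y => ?_⟩
  · linear_combination factor_quadratic hf
  · intro hk
    obtain ⟨a1, a2, a3⟩ := map_lt_add_one_of_fixed h1 h.1
    have := factor_im_pos a1 (by linarith) h.2.1 h.2.2.1 h.2.2.2
    rw [factor_im r hf, hk] at this
    by_contra! hle
    nlinarith [mul_nonneg (neg_nonneg.2 hle) (sq_nonneg (Real.sin (Real.pi * (F x - x))))]
  · rw [factor_im r hf, mul_assoc]

/-- The local behaviour of the return map at a fixed point. -/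
theorem exists_local_form (hF : Continuous F) (h1 : ∀ x, x < F x)
    (hP : ‖P‖ < 1) (hQ : ‖Q‖ < 1) (hR : ‖R‖ < 1)
    (hv : ∀ x, ∃ X ∈ ({P, Q, R} : Set ℂ), OnChord X (circleTurn x) (circleTurn (F x)))
    {x : ℝ} (hx : ret F x = x) : ∃ h k : ℝ,
      k ^ 2 = area₂ P Q R ^ 2 - (1 - ‖P‖ ^ 2) * (1 - ‖Q‖ ^ 2) * (1 - ‖R‖ ^ 2) ∧
      (k = 0 → 0 < h) ∧ ∀ᶠ y in 𝓝 x,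
        (0 < Real.sin (Real.pi * (y - x)) * (h * Real.sin (Real.pi * (y - x)) -
          k * Real.cos (Real.pi * (y - x))) → y < ret F y) ∧
        (Real.sin (Real.pi * (y - x)) * (h * Real.sin (Real.pi * (y - x)) -
          k * Real.cos (Real.pi * (y - x))) < 0 → ret F y < y) := by
  have hn : ∀ X ∈ ({P, Q, R} : Set ℂ), ‖X‖ < 1 := by rintro X (rfl | rfl | rfl) <;> assumption
  obtain ⟨X, Y, Z, hX, hY, hZ, n1, n2, n3, h⟩ := exists_isCircumscribed h1 hP hQ hR hv hx
  have hc := mem_triple_cases hX hY hZ n1 n2 n3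
  have hsub : ∀ T ∈ ({P, Q, R} : Set ℂ), T = X ∨ T = Y ∨ T = Z := by
    intro T hT
    simp only [Set.mem_insert_iff, Set.mem_singleton_iff] at hT
    grind
  have hev := h.eventually_chordEq hF h1 hv hsub (hn X hX) (hn Y hY) (hn Z hZ)
  obtain ⟨r, hr, hf⟩ := h.factor_pos h1
  have hs := eventually_sign_ret hF (hn X hX) (hn Y hY) (hn Z hZ) hx (by rw [hf]; simpa) hev
  obtain ⟨c, k, hk, hc0, hfac⟩ := h.factor_form h1
  refine ⟨c, k, ?_, hc0, ?_⟩
  · rw [hk]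
    rcases hc with ⟨rfl, rfl, rfl⟩ | ⟨rfl, rfl, rfl⟩ | ⟨rfl, rfl, rfl⟩ | ⟨rfl, rfl, rfl⟩ |
      ⟨rfl, rfl, rfl⟩ | ⟨rfl, rfl, rfl⟩ <;> simp only [area₂] <;> ring
  · filter_upwards [hs] with y hy
    rw [hfac] at hy
    exact ⟨fun h => hy.1 (by linarith), fun h => hy.2 (by linarith)⟩

theorem eventually_sin_pos (x : ℝ) : ∀ᶠ y in 𝓝[>] x, 0 < Real.sin (Real.pi * (y - x)) := by
  filter_upwards [Ioo_mem_nhdsGT (show x < x + 1 by linarith)] with y hy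
  have := Real.pi_pos
  exact Real.sin_pos_of_pos_of_lt_pi (mul_pos this (by linarith [hy.1])) (by nlinarith [hy.2])

theorem eventually_sin_neg (x : ℝ) : ∀ᶠ y in 𝓝[<] x, Real.sin (Real.pi * (y - x)) < 0 := by
  filter_upwards [Ioo_mem_nhdsLT (show x - 1 < x by linarith)] with y hy
  have := Real.pi_pos
  exact Real.sin_neg_of_neg_of_neg_pi_lt (mul_neg_of_pos_of_neg this (by linarith [hy.2]))
    (by nlinarith [hy.1])

/-- Parabolic case: `k = 0` leaves `h sin²` with `h > 0`, which does not change sign at `x`. -/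
theorem eventually_lt_ret_of_eq (hF : Continuous F) (h1 : ∀ x, x < F x)
    (hP : ‖P‖ < 1) (hQ : ‖Q‖ < 1) (hR : ‖R‖ < 1)
    (hv : ∀ x, ∃ X ∈ ({P, Q, R} : Set ℂ), OnChord X (circleTurn x) (circleTurn (F x)))
    (hD : area₂ P Q R ^ 2 = (1 - ‖P‖ ^ 2) * (1 - ‖Q‖ ^ 2) * (1 - ‖R‖ ^ 2))
    {x : ℝ} (hx : ret F x = x) : ∀ᶠ y in 𝓝[<] x, y < ret F y := by
  obtain ⟨h, k, hk, hh, hs⟩ := exists_local_form hF h1 hP hQ hR hv hx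
  obtain rfl : k = 0 := by rw [hD, sub_self] at hk; exact pow_eq_zero_iff two_ne_zero |>.1 hk
  have := hh rfl
  filter_upwards [hs.filter_mono nhdsWithin_le_nhds, eventually_sin_neg x] with y hy hy1
  refine hy.1 ?_
  have : 0 < h * (Real.sin (Real.pi * (y - x)) * Real.sin (Real.pi * (y - x))) :=
    mul_pos this (mul_pos_of_neg_of_neg hy1 hy1)
  linarith

/-- Hyperbolic case: near `x` the bracket has the sign of `-k`, while the outer sine changes sign,
so `k > 0` attracts and `k < 0` repels. -/
theorem isAttracting_or_isRepelling_of_lt (hF : Continuous F) (h1 : ∀ x, x < F x)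
    (hP : ‖P‖ < 1) (hQ : ‖Q‖ < 1) (hR : ‖R‖ < 1)
    (hv : ∀ x, ∃ X ∈ ({P, Q, R} : Set ℂ), OnChord X (circleTurn x) (circleTurn (F x)))
    (hD : (1 - ‖P‖ ^ 2) * (1 - ‖Q‖ ^ 2) * (1 - ‖R‖ ^ 2) < area₂ P Q R ^ 2)
    {x : ℝ} (hx : ret F x = x) : IsAttracting (ret F) x ∨ IsRepelling (ret F) x := by
  obtain ⟨h, k, hk, -, hs⟩ := exists_local_form hF h1 hP hQ hR hv hx
  have hk0 : k ≠ 0 := by rintro rfl; linarith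
  have hcont : Continuous fun y => h * Real.sin (Real.pi * (y - x)) -
      k * Real.cos (Real.pi * (y - x)) := by fun_prop
  have hsl := hs.filter_mono (nhdsWithin_le_nhds (s := Set.Iio x))
  have hsr := hs.filter_mono (nhdsWithin_le_nhds (s := Set.Ioi x))
  rcases lt_or_gt_of_ne hk0 with hneg | hpos
  · right
    have hg : ∀ᶠ y in 𝓝 x, 0 < h * Real.sin (Real.pi * (y - x)) -
        k * Real.cos (Real.pi * (y - x)) :=
      hcont.continuousAt.eventually_const_lt (by simpa)
    constructor
    · filter_upwards [hsl, eventually_sin_neg x, hg.filter_mono nhdsWithin_le_nhds]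
        with y g1 g2 g3 using g1.2 (mul_neg_of_neg_of_pos g2 g3)
    · filter_upwards [hsr, eventually_sin_pos x, hg.filter_mono nhdsWithin_le_nhds]
        with y g1 g2 g3 using g1.1 (mul_pos g2 g3)
  · left
    have hg : ∀ᶠ y in 𝓝 x, h * Real.sin (Real.pi * (y - x)) -
        k * Real.cos (Real.pi * (y - x)) < 0 :=
      hcont.continuousAt.eventually_lt_const (by simpa)
    constructor
    · filter_upwards [hsl, eventually_sin_neg x, hg.filter_mono nhdsWithin_le_nhds]
        with y g1 g2 g3 using g1.1 (mul_pos_of_neg_of_neg g2 g3)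
    · filter_upwards [hsr, eventually_sin_pos x, hg.filter_mono nhdsWithin_le_nhds]
        with y g1 g2 g3 using g1.2 (mul_neg_of_pos_of_neg g2 g3)

/-! ### Counting periodic orbits -/

/-- Two more applications of `F` to the relation return `y` up to a turn, because `F³ y = y + 1`. -/
theorem sameOrbit_of_sameOrbit_map {x y : ℝ} (hx : ret F x = x) (hy : ret F y = y)
    (h : SameOrbit F x (F y)) : SameOrbit F x y := by
  have h3 := map_map_map_of_fixed hx
  have h3' := map_map_map_of_fixed hy
  obtain ⟨m, h | h | h⟩ := h
  · refine ⟨m - 1, Or.inr (Or.inr ?_)⟩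
    rw [h, F.map_add_int, F.map_add_int] at h3'
    push_cast; linarith
  · refine ⟨m, Or.inl ?_⟩
    rw [h, F.map_add_int, F.map_add_int, h3] at h3'
    linarith
  · refine ⟨m, Or.inr (Or.inl ?_)⟩
    rw [h, F.map_add_int, F.map_add_int, h3, F.map_add_one] at h3'
    linarith

/-- With the vertices labelled counterclockwise, every periodic orbit has a point from which the
sides pass through the vertices in this order. -/
theorem exists_labelling (h1 : ∀ x, x < F x) (hP : ‖P‖ < 1) (hQ : ‖Q‖ < 1) (hR : ‖R‖ < 1)
    (hv : ∀ x, ∃ X ∈ ({P, Q, R} : Set ℂ), OnChord X (circleTurn x) (circleTurn (F x))) :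
    ∃ A B C : ℂ, ((A = P ∧ B = Q ∧ C = R) ∨ (A = P ∧ B = R ∧ C = Q)) ∧
      ∀ x, ret F x = x → ∃ y, (y = x ∨ y = F x ∨ y = F (F x)) ∧
      IsCircumscribed F A B C y := by
  have hn : ∀ X ∈ ({P, Q, R} : Set ℂ), ‖X‖ < 1 := by rintro X (rfl | rfl | rfl) <;> assumption
  have hswap : ∀ X Y Z : ℂ, area₂ X Z Y = -area₂ X Y Z := fun X Y Z => by
    simp only [area₂]; ring
  have hrot : ∀ X Y Z : ℂ, area₂ Y Z X = area₂ X Y Z := fun X Y Z => by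
    simp only [area₂]; ring
  have key : ∃ A B C : ℂ, ((A = P ∧ B = Q ∧ C = R) ∨ (A = P ∧ B = R ∧ C = Q)) ∧
      ∀ x, ret F x = x → IsCircumscribed F A B C x ∨
      IsCircumscribed F B C A x ∨ IsCircumscribed F C A B x := by
    have main : ∀ x, ret F x = x → ∃ X Y Z, 0 < area₂ X Y Z ∧ IsCircumscribed F X Y Z x ∧
      ((X = P ∧ Y = Q ∧ Z = R) ∨ (X = Q ∧ Y = R ∧ Z = P) ∨ (X = R ∧ Y = P ∧ Z = Q) ∨
        (X = P ∧ Y = R ∧ Z = Q) ∨ (X = R ∧ Y = Q ∧ Z = P) ∨ (X = Q ∧ Y = P ∧ Z = R)) := by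
      intro x hx
      obtain ⟨X, Y, Z, hX, hY, hZ, n1, n2, n3, h⟩ := exists_isCircumscribed h1 hP hQ hR hv hx
      exact ⟨X, Y, Z, h.area_pos h1 (hn X hX) (hn Y hY) (hn Z hZ), h,
        mem_triple_cases hX hY hZ n1 n2 n3⟩
    have r1 := hrot P Q R
    have r2 := hrot Q R P
    have r3 := hrot P R Q
    have r4 := hrot R Q P
    have r5 := hswap P Q R
    -- A circumscribed orbit meets the vertices in an order of positive area, so the sign of the
    -- area selects one of the two cyclic orders for all orbits at once.
    rcases lt_or_ge 0 (area₂ P Q R) with hpos | hneg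
    · refine ⟨P, Q, R, by simp, fun x hx => ?_⟩
      obtain ⟨X, Y, Z, ha, h, hc⟩ := main x hx
      rcases hc with ⟨rfl, rfl, rfl⟩ | ⟨rfl, rfl, rfl⟩ | ⟨rfl, rfl, rfl⟩ | ⟨rfl, rfl, rfl⟩ |
        ⟨rfl, rfl, rfl⟩ | ⟨rfl, rfl, rfl⟩
      · exact Or.inl h
      · exact Or.inr (Or.inl h)
      · exact Or.inr (Or.inr h)
      all_goals linarith
    · refine ⟨P, R, Q, by simp, fun x hx => ?_⟩
      obtain ⟨X, Y, Z, ha, h, hc⟩ := main x hx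
      rcases hc with ⟨rfl, rfl, rfl⟩ | ⟨rfl, rfl, rfl⟩ | ⟨rfl, rfl, rfl⟩ | ⟨rfl, rfl, rfl⟩ |
        ⟨rfl, rfl, rfl⟩ | ⟨rfl, rfl, rfl⟩
      · linarith
      · linarith
      · linarith
      · exact Or.inl h
      · exact Or.inr (Or.inl h)
      · exact Or.inr (Or.inr h)
  obtain ⟨A, B, C, hABC, h⟩ := key
  refine ⟨A, B, C, hABC, fun x hx => ?_⟩
  rcases h x hx with h | h | h
  · exact ⟨x, Or.inl rfl, h⟩
  · exact ⟨_, Or.inr (Or.inr rfl), h.rotate.rotate⟩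
  · exact ⟨_, Or.inr (Or.inl rfl), h.rotate⟩

theorem exists_int_of_sin_eq_zero {t : ℝ} (h : Real.sin (Real.pi * t) = 0) :
    ∃ m : ℤ, t = m := by
  obtain ⟨m, hm⟩ := Real.sin_eq_zero_iff.1 h
  exact ⟨m, mul_left_cancel₀ Real.pi_ne_zero (by linarith)⟩

theorem sameOrbit_of_translate {x y x' y' : ℝ} {m : ℤ} (hx : ret F x = x) (hy : ret F y = y)
    (hx' : x' = x ∨ x' = F x ∨ x' = F (F x)) (hy' : y' = y ∨ y' = F y ∨ y' = F (F y))
    (h : y' - x' = m) : SameOrbit F x y := by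
  have h0 : SameOrbit F x y' := by
    refine ⟨m, ?_⟩
    rcases hx' with rfl | rfl | rfl
    · left; linarith
    · right; left; linarith
    · right; right; linarith
  rcases hy' with rfl | rfl | rfl
  · exact h0
  · exact sameOrbit_of_sameOrbit_map hx hy h0
  · exact sameOrbit_of_sameOrbit_map hx hy
      (sameOrbit_of_sameOrbit_map hx (ret_fixed_map hy) h0)

/-- On the labelled periodic points, the imaginary part of the automorphy factor vanishes. -/
theorem exists_periodic_form (h1 : ∀ x, x < F x) (hP : ‖P‖ < 1) (hQ : ‖Q‖ < 1)
    (hR : ‖R‖ < 1)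
    (hv : ∀ x, ∃ X ∈ ({P, Q, R} : Set ℂ), OnChord X (circleTurn x) (circleTurn (F x)))
    {x : ℝ} (hx : ret F x = x) : ∃ c k x' : ℝ,
      k ^ 2 = area₂ P Q R ^ 2 - (1 - ‖P‖ ^ 2) * (1 - ‖Q‖ ^ 2) * (1 - ‖R‖ ^ 2) ∧
      (k = 0 → 0 < c) ∧ (x' = x ∨ x' = F x ∨ x' = F (F x)) ∧
      ∀ y, ret F y = y → ∃ y', (y' = y ∨ y' = F y ∨ y' = F (F y)) ∧
        Real.sin (Real.pi * (y' - x')) * (c * Real.sin (Real.pi * (y' - x')) -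
          k * Real.cos (Real.pi * (y' - x'))) = 0 := by
  obtain ⟨A, B, C, hABC, h⟩ := exists_labelling h1 hP hQ hR hv
  obtain ⟨x', hx', hc⟩ := h x hx
  obtain ⟨c, k, hk, hc0, hfac⟩ := hc.factor_form h1
  refine ⟨c, k, x', ?_, hc0, hx', fun y hy => ?_⟩
  · rw [hk]
    rcases hABC with ⟨rfl, rfl, rfl⟩ | ⟨rfl, rfl, rfl⟩ <;> simp only [area₂]
    ring
  · obtain ⟨y', hy', hcy⟩ := h y hy
    refine ⟨y', hy', ?_⟩
    obtain ⟨r, -, hr⟩ := hcy.factor_pos h1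
    have := hfac y'
    rw [hr, Complex.ofReal_im] at this
    linarith

theorem sameOrbit_of_eq (h1 : ∀ x, x < F x) (hP : ‖P‖ < 1) (hQ : ‖Q‖ < 1) (hR : ‖R‖ < 1)
    (hv : ∀ x, ∃ X ∈ ({P, Q, R} : Set ℂ), OnChord X (circleTurn x) (circleTurn (F x)))
    (hD : area₂ P Q R ^ 2 = (1 - ‖P‖ ^ 2) * (1 - ‖Q‖ ^ 2) * (1 - ‖R‖ ^ 2))
    {x y : ℝ} (hx : ret F x = x) (hy : ret F y = y) : SameOrbit F x y := by
  obtain ⟨c, k, x', hk, hc, hx', h⟩ := exists_periodic_form h1 hP hQ hR hv hx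
  obtain rfl : k = 0 := by rw [hD, sub_self] at hk; exact pow_eq_zero_iff two_ne_zero |>.1 hk
  obtain ⟨y', hy', hs⟩ := h y hy
  have hc0 := (hc rfl).ne'
  have hs0 : Real.sin (Real.pi * (y' - x')) = 0 := by
    rw [zero_mul, sub_zero] at hs
    rcases mul_eq_zero.1 hs with h | h
    · exact h
    · exact (mul_eq_zero.1 h).resolve_left hc0
  obtain ⟨m, hm⟩ := exists_int_of_sin_eq_zero hs0
  exact sameOrbit_of_translate hx hy hx' hy' hm

theorem sameOrbit_of_lt (h1 : ∀ x, x < F x) (hP : ‖P‖ < 1) (hQ : ‖Q‖ < 1) (hR : ‖R‖ < 1)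
    (hv : ∀ x, ∃ X ∈ ({P, Q, R} : Set ℂ), OnChord X (circleTurn x) (circleTurn (F x)))
    (hD : (1 - ‖P‖ ^ 2) * (1 - ‖Q‖ ^ 2) * (1 - ‖R‖ ^ 2) < area₂ P Q R ^ 2)
    {x y z : ℝ} (hx : ret F x = x) (hy : ret F y = y) (hz : ret F z = z) :
    SameOrbit F x y ∨ SameOrbit F x z ∨ SameOrbit F y z := by
  obtain ⟨c, k, x', hk, -, hx', h⟩ := exists_periodic_form h1 hP hQ hR hv hx
  have hk0 : k ≠ 0 := by rintro rfl; linarith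
  obtain ⟨y', hy', hsy⟩ := h y hy
  obtain ⟨z', hz', hsz⟩ := h z hz
  rcases mul_eq_zero.1 hsy with hy0 | hy0
  · obtain ⟨m, hm⟩ := exists_int_of_sin_eq_zero hy0
    exact Or.inl (sameOrbit_of_translate hx hy hx' hy' hm)
  rcases mul_eq_zero.1 hsz with hz0 | hz0
  · obtain ⟨m, hm⟩ := exists_int_of_sin_eq_zero hz0
    exact Or.inr (Or.inl (sameOrbit_of_translate hx hz hx' hz' hm))
  -- Both angles solve `c sin θ = k cos θ`; eliminating `c` gives `k sin(θ_z - θ_y) = 0`, so the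
  -- second zero is unique modulo a turn.
  have hs : Real.sin (Real.pi * (z' - y')) = 0 := by
    rw [show Real.pi * (z' - y') = Real.pi * (z' - x') - Real.pi * (y' - x') by ring,
      Real.sin_sub]
    refine (mul_eq_zero.1 ?_).resolve_left hk0
    linear_combination Real.sin (Real.pi * (y' - x')) * hz0 -
      Real.sin (Real.pi * (z' - x')) * hy0
  obtain ⟨m, hm⟩ := exists_int_of_sin_eq_zero hs
  exact Or.inr (Or.inr (sameOrbit_of_translate hy hz hy' hz' hm))

end orbit

/-! ### Distances in the Beltrami-Klein disk -/

/-- The Lorentzian product of two points of the Beltrami-Klein disk. -/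
def kleinForm (A B : ℂ) : ℝ := 1 - (A.re * B.re + A.im * B.im)

theorem kleinForm_self (A : ℂ) : kleinForm A A = 1 - ‖A‖ ^ 2 := by
  rw [Complex.sq_norm, Complex.normSq_apply]; rfl

theorem kleinForm_self_pos {A : ℂ} (hA : ‖A‖ < 1) : 0 < kleinForm A A := by
  rw [kleinForm_self]; nlinarith [norm_nonneg A]

theorem one_le_poincare_arg {A B : ℂ} (hA : ‖A‖ < 1) (hB : ‖B‖ < 1) :
    1 ≤ 1 + 2 * ‖A - B‖ ^ 2 / ((1 - ‖A‖ ^ 2) * (1 - ‖B‖ ^ 2)) := by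
  have h1 := kleinForm_self_pos hA
  have h2 := kleinForm_self_pos hB
  rw [kleinForm_self] at h1 h2
  have : 0 ≤ 2 * ‖A - B‖ ^ 2 / ((1 - ‖A‖ ^ 2) * (1 - ‖B‖ ^ 2)) := by positivity
  linarith

theorem norm_kleinToPoincare_sq {A : ℂ} :
    ‖kleinToPoincare A‖ ^ 2 = ‖A‖ ^ 2 / (1 + √(1 - ‖A‖ ^ 2)) ^ 2 := by
  rw [kleinToPoincare, norm_div, div_pow, Complex.norm_real, Real.norm_eq_abs, sq_abs]

theorem norm_kleinToPoincare_lt {A : ℂ} (hA : ‖A‖ < 1) : ‖kleinToPoincare A‖ < 1 := by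
  have h := kleinForm_self_pos hA
  rw [kleinForm_self] at h
  have hs := Real.sqrt_pos.2 h
  rw [kleinToPoincare, norm_div, Complex.norm_real, Real.norm_eq_abs, abs_of_pos (by linarith),
    div_lt_one (by linarith)]
  linarith

/-- The hyperboloid formula for the distance. It rests on `1 - |G⁻¹A|² = 2a / (1 + a)` with `a = √(1
- |A|²)`. -/
theorem cosh_kleinDist {A B : ℂ} (hA : ‖A‖ < 1) (hB : ‖B‖ < 1) :
    Real.cosh (kleinDist A B) = kleinForm A B / (√(kleinForm A A) * √(kleinForm B B)) := by
  rw [kleinDist, poincareDist, Real.cosh_arcosh (one_le_poincare_arg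
    (norm_kleinToPoincare_lt hA) (norm_kleinToPoincare_lt hB)), norm_kleinToPoincare_sq,
    norm_kleinToPoincare_sq]
  have ha := kleinForm_self_pos hA
  have hb := kleinForm_self_pos hB
  have hsub : ‖kleinToPoincare A - kleinToPoincare B‖ ^ 2 =
      (A.re / (1 + √(1 - ‖A‖ ^ 2)) - B.re / (1 + √(1 - ‖B‖ ^ 2))) ^ 2 +
      (A.im / (1 + √(1 - ‖A‖ ^ 2)) - B.im / (1 + √(1 - ‖B‖ ^ 2))) ^ 2 := by
    rw [Complex.sq_norm, Complex.normSq_apply, kleinToPoincare, kleinToPoincare]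
    simp only [Complex.sub_re, Complex.sub_im, Complex.div_ofReal_re, Complex.div_ofReal_im]
    ring
  have hnA : ‖A‖ ^ 2 = A.re ^ 2 + A.im ^ 2 := by
    rw [Complex.sq_norm, Complex.normSq_apply]; ring
  have hnB : ‖B‖ ^ 2 = B.re ^ 2 + B.im ^ 2 := by
    rw [Complex.sq_norm, Complex.normSq_apply]; ring
  rw [hsub, kleinForm_self, kleinForm_self]
  rw [kleinForm_self] at ha hb
  have ha2 := Real.sq_sqrt ha.le
  have hb2 := Real.sq_sqrt hb.le
  have ha0 := Real.sqrt_pos.2 ha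
  have hb0 := Real.sqrt_pos.2 hb
  set a := √(1 - ‖A‖ ^ 2)
  set b := √(1 - ‖B‖ ^ 2)
  have e1 : 1 - ‖A‖ ^ 2 / (1 + a) ^ 2 = 2 * a / (1 + a) := by
    field_simp; linear_combination -ha2
  have e2 : 1 - ‖B‖ ^ 2 / (1 + b) ^ 2 = 2 * b / (1 + b) := by
    field_simp; linear_combination -hb2
  rw [hnA] at ha2
  rw [hnB] at hb2
  rw [e1, e2, kleinForm]
  field_simp
  linear_combination (1 + b) ^ 2 * ha2 + (1 + a) ^ 2 * hb2

theorem cosh_kleinDist_sq {A B : ℂ} (hA : ‖A‖ < 1) (hB : ‖B‖ < 1) :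
    Real.cosh (kleinDist A B) ^ 2 = kleinForm A B ^ 2 / (kleinForm A A * kleinForm B B) := by
  rw [cosh_kleinDist hA hB, div_pow, mul_pow, Real.sq_sqrt (kleinForm_self_pos hA).le,
    Real.sq_sqrt (kleinForm_self_pos hB).le]

theorem kleinDist_nonneg {A B : ℂ} (hA : ‖A‖ < 1) (hB : ‖B‖ < 1) : 0 ≤ kleinDist A B :=
  Real.arcosh_nonneg (one_le_poincare_arg (norm_kleinToPoincare_lt hA)
    (norm_kleinToPoincare_lt hB))

/-- The negative of the Gram determinant of two points. -/
def kleinGram (P Q : ℂ) : ℝ := kleinForm P Q ^ 2 - kleinForm P P * kleinForm Q Q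

/-- The strict reversed Cauchy–Schwarz inequality for timelike vectors, here from an explicit sum of
nonnegative terms. -/
theorem kleinGram_pos {P Q : ℂ} (hP : ‖P‖ < 1) (hPQ : P ≠ Q) : 0 < kleinGram P Q := by
  have h1 := kleinForm_self_pos hP
  have h2 : 0 < (Q.re - P.re) ^ 2 + (Q.im - P.im) ^ 2 := by
    have := Complex.normSq_pos.2 (sub_ne_zero.2 hPQ.symm)
    rw [Complex.normSq_apply] at this
    simp only [Complex.sub_re, Complex.sub_im] at this
    nlinarith
  have h3 : kleinGram P Q = kleinForm P P * ((Q.re - P.re) ^ 2 + (Q.im - P.im) ^ 2) +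
      (P.re * (Q.re - P.re) + P.im * (Q.im - P.im)) ^ 2 := by
    unfold kleinGram kleinForm; ring
  rw [h3]; positivity

/-- As `e^Δ' = coth(d'/2)`, one has `cosh Δ' = coth d'`, and `cosh² d' - 1` is the Gram term divided
by the product of the self-forms. -/
theorem cosh_kleinDelta_sq {P Q : ℂ} (hP : ‖P‖ < 1) (hQ : ‖Q‖ < 1) (hPQ : P ≠ Q) :
    0 ≤ kleinDelta P Q ∧
      Real.cosh (kleinDelta P Q) ^ 2 = kleinForm P Q ^ 2 / kleinGram P Q := by
  have hK := kleinGram_pos hP hPQ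
  have hp := kleinForm_self_pos hP
  have hq := kleinForm_self_pos hQ
  have hc := cosh_kleinDist_sq hP hQ
  have hd0 := kleinDist_nonneg hP hQ
  have hd : 0 < kleinDist P Q := by
    refine lt_of_le_of_ne hd0 fun h => ?_
    rw [← h, Real.cosh_zero, eq_div_iff (by positivity)] at hc
    unfold kleinGram at hK
    linarith
  change 0 ≤ Real.log ((Real.exp (kleinDist P Q) + 1) / (Real.exp (kleinDist P Q) - 1)) ∧
    Real.cosh (Real.log ((Real.exp (kleinDist P Q) + 1) / (Real.exp (kleinDist P Q) - 1))) ^ 2 = _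
  have hE := Real.one_lt_exp_iff.2 hd
  have hcosh : Real.cosh (kleinDist P Q) =
      (Real.exp (kleinDist P Q) + (Real.exp (kleinDist P Q))⁻¹) / 2 := by
    rw [Real.cosh_eq, Real.exp_neg]
  set E := Real.exp (kleinDist P Q)
  have hE1 : 0 < E - 1 := by linarith
  have hE0 : 0 < E := by linarith
  constructor
  · exact Real.log_nonneg (by rw [le_div_iff₀ hE1]; linarith)
  · rw [Real.cosh_log (by positivity)]
    rw [hcosh, eq_div_iff (by positivity)] at hc
    have hK' : kleinGram P Q = ((E - 1) * (E + 1) / (2 * E)) ^ 2 *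
        (kleinForm P P * kleinForm Q Q) := by
      rw [kleinGram, ← hc]; field_simp; ring
    rw [hK', ← hc]
    field_simp
    ring

/-- Along the line `PQ` the deviation from the minimal distance is the square of an affine function
of `t`: nonnegativity bounds the distance from `R` below, and its zero is the foot of the
perpendicular. -/
theorem kleinForm_line (P Q R : ℂ) (t : ℝ) :
    kleinGram P Q * kleinForm R (P + t * (Q - P)) ^ 2 -
      kleinForm (P + t * (Q - P)) (P + t * (Q - P)) *
        (kleinGram P Q * kleinForm R R + area₂ P Q R ^ 2) =
      ((1 - t) * (kleinForm R P * kleinForm P Q - kleinForm R Q * kleinForm P P) -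
        t * (kleinForm R Q * kleinForm P Q - kleinForm R P * kleinForm Q Q)) ^ 2 := by
  simp only [kleinGram, kleinForm, area₂, Complex.add_re, Complex.add_im, Complex.re_ofReal_mul,
    Complex.im_ofReal_mul, Complex.sub_re, Complex.sub_im]
  ring

theorem mem_line_iff {P Q S : ℂ} : S ∈ line[ℝ, P, Q] ↔ ∃ t : ℝ, S = P + t * (Q - P) := by
  conv_lhs => rw [← sub_add_cancel S P, ← vadd_eq_add]
  rw [vadd_left_mem_affineSpan_pair]
  refine exists_congr fun t => ?_
  rw [vsub_eq_sub, Complex.real_smul, eq_comm, sub_eq_iff_eq_add']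

theorem exists_foot {P Q R : ℂ} (hP : ‖P‖ < 1) (hR : ‖R‖ < 1) (hPQ : P ≠ Q) :
    ∃ S ∈ line[ℝ, P, Q], ‖S‖ < 1 ∧ kleinGram P Q * kleinForm R S ^ 2 =
      kleinForm S S * (kleinGram P Q * kleinForm R R + area₂ P Q R ^ 2) := by
  have hK := kleinGram_pos hP hPQ
  have hr := kleinForm_self_pos hR
  have hpos : 0 < kleinGram P Q * kleinForm R R + area₂ P Q R ^ 2 := by positivity
  set y := kleinForm R P * kleinForm P Q - kleinForm R Q * kleinForm P P with hy
  set x := kleinForm R Q * kleinForm P Q - kleinForm R P * kleinForm Q Q with hx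
  -- The slope of that affine function is `-(x + y)`; this identity shows it is nonzero, so the foot
  -- is at `t = y / (x + y)`.
  have hlead : (x + y) ^ 2 =
      kleinGram P Q * (R.re * (Q.re - P.re) + R.im * (Q.im - P.im)) ^ 2 +
      ((Q.re - P.re) ^ 2 + (Q.im - P.im) ^ 2) *
        (kleinGram P Q * kleinForm R R + area₂ P Q R ^ 2) := by
    rw [hx, hy]
    simp only [kleinGram, kleinForm, area₂]
    ring
  have h2 : 0 < (Q.re - P.re) ^ 2 + (Q.im - P.im) ^ 2 := by
    have := Complex.normSq_pos.2 (sub_ne_zero.2 hPQ.symm)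
    rw [Complex.normSq_apply] at this
    simp only [Complex.sub_re, Complex.sub_im] at this
    nlinarith
  have hxy : x + y ≠ 0 := by
    intro h0
    rw [h0] at hlead
    have : 0 < ((Q.re - P.re) ^ 2 + (Q.im - P.im) ^ 2) *
        (kleinGram P Q * kleinForm R R + area₂ P Q R ^ 2) := by positivity
    nlinarith [mul_nonneg hK.le (sq_nonneg (R.re * (Q.re - P.re) + R.im * (Q.im - P.im)))]
  have hline := kleinForm_line P Q R (y / (x + y))
  rw [← hx, ← hy] at hline
  have hzero : ((1 - y / (x + y)) * y - y / (x + y) * x) ^ 2 = 0 := by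
    field_simp; ring
  rw [hzero, sub_eq_zero] at hline
  refine ⟨_, mem_line_iff.2 ⟨_, rfl⟩, ?_, hline⟩
  generalize P + ((y / (x + y) : ℝ) : ℂ) * (Q - P) = S at hline
  have hSS : 0 ≤ kleinForm S S := by
    have : 0 ≤ kleinForm S S * (kleinGram P Q * kleinForm R R + area₂ P Q R ^ 2) := by
      rw [← hline]; positivity
    exact nonneg_of_mul_nonneg_left this hpos
  -- A foot on the unit circle would also satisfy `⟨R, S⟩ = 0`, and then `⟨R, R⟩ = -|R - S|² ≤ 0`,
  -- which is impossible inside the disk.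
  have hne : kleinForm S S ≠ 0 := by
    intro h0
    rw [h0, zero_mul] at hline
    have h3 : kleinForm R S = 0 := by
      have := (mul_eq_zero.1 hline).resolve_left hK.ne'
      exact pow_eq_zero_iff two_ne_zero |>.1 this
    unfold kleinForm at h0 h3 hr
    nlinarith [sq_nonneg (R.re - S.re), sq_nonneg (R.im - S.im)]
  have hlt := lt_of_le_of_ne hSS hne.symm
  rw [kleinForm_self] at hlt
  nlinarith [norm_nonneg S]

theorem cosh_distToLine_sq {P Q R : ℂ} (hP : ‖P‖ < 1) (hR : ‖R‖ < 1) (hPQ : P ≠ Q) :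
    0 ≤ distToLine P Q R ∧ Real.cosh (distToLine P Q R) ^ 2 =
      1 + area₂ P Q R ^ 2 / (kleinGram P Q * kleinForm R R) := by
  have hK := kleinGram_pos hP hPQ
  have hr := kleinForm_self_pos hR
  obtain ⟨S, hS, hS1, hSe⟩ := exists_foot hP hR hPQ
  have hc : ∀ T : ℂ, ‖T‖ < 1 → kleinForm T T *
      (kleinGram P Q * kleinForm R R + area₂ P Q R ^ 2) ≤ kleinGram P Q * kleinForm R T ^ 2 →
      1 + area₂ P Q R ^ 2 / (kleinGram P Q * kleinForm R R) ≤ Real.cosh (kleinDist R T) ^ 2 := by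
    intro T hT hle
    have ht := kleinForm_self_pos hT
    rw [cosh_kleinDist_sq hR hT, one_add_div (by positivity), div_le_div_iff₀ (by positivity)
      (by positivity)]
    nlinarith
  have hSc : Real.cosh (kleinDist R S) ^ 2 =
      1 + area₂ P Q R ^ 2 / (kleinGram P Q * kleinForm R R) := by
    have hs := kleinForm_self_pos hS1
    rw [cosh_kleinDist_sq hR hS1, one_add_div (by positivity), div_eq_div_iff (by positivity)
      (by positivity)]
    linear_combination kleinForm R R * hSe
  have hleast : IsLeast (kleinDist R '' {S : ℂ | S ∈ line[ℝ, P, Q] ∧ ‖S‖ < 1})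
      (kleinDist R S) := by
    refine ⟨⟨S, ⟨hS, hS1⟩, rfl⟩, ?_⟩
    rintro _ ⟨T, ⟨hT, hT1⟩, rfl⟩
    have h1 : Real.cosh (kleinDist R S) ^ 2 ≤ Real.cosh (kleinDist R T) ^ 2 := by
      rw [hSc]
      refine hc T hT1 ?_
      obtain ⟨t, rfl⟩ := mem_line_iff.1 hT
      rw [← sub_nonneg, kleinForm_line]
      positivity
    have h2 := Real.cosh_le_cosh.1 ((pow_le_pow_iff_left₀ (Real.cosh_pos _).le
      (Real.cosh_pos _).le two_ne_zero).1 h1)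
    rwa [abs_of_nonneg (kleinDist_nonneg hR hS1), abs_of_nonneg (kleinDist_nonneg hR hT1)] at h2
  rw [distToLine, hleast.csInf_eq]
  exact ⟨kleinDist_nonneg hR hS1, hSc⟩

/-- The distance condition in terms of the Euclidean area. -/
theorem kleinDelta_le_distToLine_iff {P Q R : ℂ} (hP : ‖P‖ < 1) (hQ : ‖Q‖ < 1) (hR : ‖R‖ < 1)
    (hPQ : P ≠ Q) :
    (kleinDelta P Q ≤ distToLine P Q R ↔
      (1 - ‖P‖ ^ 2) * (1 - ‖Q‖ ^ 2) * (1 - ‖R‖ ^ 2) ≤ area₂ P Q R ^ 2) ∧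
    (distToLine P Q R ≤ kleinDelta P Q ↔
      area₂ P Q R ^ 2 ≤ (1 - ‖P‖ ^ 2) * (1 - ‖Q‖ ^ 2) * (1 - ‖R‖ ^ 2)) := by
  obtain ⟨h1, h2⟩ := cosh_kleinDelta_sq hP hQ hPQ
  obtain ⟨h3, h4⟩ := cosh_distToLine_sq hP hR hPQ
  have hK := kleinGram_pos hP hPQ
  have hr := kleinForm_self_pos hR
  have key : ∀ a b : ℝ, 0 ≤ a → 0 ≤ b → (a ≤ b ↔ Real.cosh a ^ 2 ≤ Real.cosh b ^ 2) := by
    intro a b ha hb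
    rw [pow_le_pow_iff_left₀ (Real.cosh_pos _).le (Real.cosh_pos _).le two_ne_zero,
      Real.cosh_le_cosh, abs_of_nonneg ha, abs_of_nonneg hb]
  have h5 : kleinForm P Q ^ 2 / kleinGram P Q =
      1 + kleinForm P P * kleinForm Q Q * kleinForm R R / (kleinGram P Q * kleinForm R R) := by
    rw [one_add_div (by positivity), div_eq_div_iff hK.ne' (by positivity)]
    unfold kleinGram; ring
  rw [h5] at h2
  rw [key _ _ h1 h3, key _ _ h3 h1, h2, h4, ← kleinForm_self, ← kleinForm_self,
    ← kleinForm_self, add_le_add_iff_left, add_le_add_iff_left,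
    div_le_div_iff_of_pos_right (by positivity), div_le_div_iff_of_pos_right (by positivity)]
  exact ⟨Iff.rfl, Iff.rfl⟩

/-! ### Lifts of `ψ` -/

/-- A point with `F z ≤ z`, together with `F 0 > 0`, would produce a fixed point of `ψ`. -/
theorem lt_lift {F : CircleDeg1Lift} {ψ : Circle → Circle} (hF : Continuous F)
    (hψ : ∀ x, circleTurn (F x) = ψ (circleTurn x)) (hne : ∀ v, ψ v ≠ v)
    (h0 : F 0 ∈ Set.Ioo (0 : ℝ) 1) (x : ℝ) : x < F x := by
  by_contra! hle
  have h := intermediate_value_uIcc (a := 0) (b := x) (f := fun x => F x - x) (by fun_prop)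
  obtain ⟨z, -, hz⟩ := h (show (0 : ℝ) ∈ _ by
    rw [Set.mem_uIcc]; right; constructor <;> linarith [h0.1])
  have hz' : F z = z := by simpa [sub_eq_zero] using hz
  exact hne (circleTurn z) (by rw [← hψ, hz'])

/-- If `F³ x = x + m + 1`, the translation number is `(m + 1) / 3`, so rotation number `1 / 3`
forces `m = 0`. -/
theorem ret_eq_of_iterate {F : CircleDeg1Lift} {ψ : Circle → Circle}
    (hψ : ∀ x, circleTurn (F x) = ψ (circleTurn x)) (hτ : F.translationNumber = 1 / 3) {x : ℝ}
    (h : ψ^[3] (circleTurn x) = circleTurn x) : ret F x = x := by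
  rw [iterate_three_circleTurn hψ, circleTurn_eq_iff] at h
  obtain ⟨m, hm⟩ := h
  have h1 : (F ^ 3) x = x + ((m + 1 : ℤ) : ℝ) := by
    rw [CircleDeg1Lift.coe_pow]
    show F (F (F x)) = _
    unfold ret at hm; push_cast; linarith
  have h2 := F.translationNumber_of_map_pow_eq_add_int h1 (by norm_num)
  rw [hτ] at h2
  have h3 : (m : ℝ) = 0 := by push_cast at h2; linarith
  rw [hm, h3, add_zero]

theorem exists_ret_eq {F : CircleDeg1Lift} (hF : Continuous F)
    (hτ : F.translationNumber = 1 / 3) : ∃ x, ret F x = x := by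
  have h := (F.translationNumber_eq_rat_iff hF (m := 1) (n := 3) (by norm_num)).1
    (by rw [hτ]; norm_num)
  obtain ⟨x, hx⟩ := h
  rw [CircleDeg1Lift.coe_pow] at hx
  refine ⟨x, ?_⟩
  have : F (F (F x)) = x + (1 : ℤ) := hx
  rw [ret, this]; simp

end KleinTriangle

/-! ### The theorem: the parabolic and the hyperbolic case -/

theorem theorem4p3 (P Q R : ℂ) (hT : IsTriangleInDisk P Q R)
    (ψ : Circle → Circle) (hψ : ψ = psi P Q R) (hρ : HasRotationNumber ψ (1 / 3)) :
    -- case of equality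
    (distToLine P Q R = kleinDelta P Q →
      ¬ IsConjugateToRotation ψ ∧
      (∃ u₁, ψ^[3] u₁ = u₁) ∧
      ∀ u₁ u₂ u₃, ψ^[3] u₁ = u₁ → u₂ = ψ u₁ → u₃ = ψ^[2] u₁ →
        -- `u₁, u₂, u₃` is the only 3-periodic orbit
        [u₁, u₂, u₃].Nodup ∧
        (∀ z, ψ^[3] z = z → z ∈ [u₁, u₂, u₃]) ∧
        -- and each half-open arc is attracted by its end point
        (∀ z ∈ arc u₃ u₁ \ {u₃}, Tendsto (fun n : ℕ => ψ^[3 * n] z) atTop (𝓝 u₁)) ∧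
        (∀ z ∈ arc u₁ u₂ \ {u₁}, Tendsto (fun n : ℕ => ψ^[3 * n] z) atTop (𝓝 u₂)) ∧
        (∀ z ∈ arc u₂ u₃ \ {u₂}, Tendsto (fun n : ℕ => ψ^[3 * n] z) atTop (𝓝 u₃))) ∧
    -- case of strict inequality
    (kleinDelta P Q < distToLine P Q R →
      ¬ IsConjugateToRotation ψ ∧
      (∃ u₁, ψ^[3] u₁ = u₁ ∧ ∃ w, w ∉ [u₁, ψ u₁, ψ^[2] u₁] ∧
        Tendsto (fun n : ℕ => ψ^[3 * n] w) atTop (𝓝 u₁)) ∧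
      ∀ u₁ u₂ u₃, ψ^[3] u₁ = u₁ → u₂ = ψ u₁ → u₃ = ψ^[2] u₁ →
        (∃ w, w ∉ [u₁, u₂, u₃] ∧ Tendsto (fun n : ℕ => ψ^[3 * n] w) atTop (𝓝 u₁)) →
        (∃ v₁ ∈ arc u₁ u₂ \ {u₁}, v₁ ≠ u₂ ∧ ψ^[3] v₁ = v₁) ∧
        ∀ v₁ v₂ v₃, v₁ ∈ arc u₁ u₂ \ {u₁} → v₁ ≠ u₂ → ψ^[3] v₁ = v₁ →
          v₂ = ψ v₁ → v₃ = ψ^[2] v₁ →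
          -- the `u`s and the `v`s are exactly two 3-periodic orbits
          [u₁, u₂, u₃, v₁, v₂, v₃].Nodup ∧
          (∀ z, ψ^[3] z = z → z ∈ [u₁, u₂, u₃, v₁, v₂, v₃]) ∧
          -- and the open arcs between the `v`s are attracted by the `u`s
          (∀ z ∈ arc v₃ v₁ \ {v₃, v₁}, Tendsto (fun n : ℕ => ψ^[3 * n] z) atTop (𝓝 u₁)) ∧
          (∀ z ∈ arc v₁ v₂ \ {v₁, v₂}, Tendsto (fun n : ℕ => ψ^[3 * n] z) atTop (𝓝 u₂)) ∧
          (∀ z ∈ arc v₂ v₃ \ {v₂, v₃}, Tendsto (fun n : ℕ => ψ^[3 * n] z) atTop (𝓝 u₃))) := by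

  obtain ⟨F, hF, hsemi, h0, hτ⟩ := hρ
  obtain ⟨hA, hP, hQ, hR⟩ := id hT
  have hPQ : P ≠ Q := fun h => by
    have := hA.injective.ne (show (0 : Fin 3) ≠ 1 by decide)
    exact this h
  have htan : ∀ v, v ≠ ψ v ∧ ∃ X ∈ ({P, Q, R} : Set ℂ), OnChord X v (ψ v) := fun v => by
    rw [hψ]; exact (psi_spec hT v).1.exists_onChord hT
  have hlift : ∀ x, circleTurn (F x) = ψ (circleTurn x) := hsemi
  have h1 := lt_lift hF hlift (fun v => (htan v).1.symm) h0
  have hv : ∀ x, ∃ X ∈ ({P, Q, R} : Set ℂ), OnChord X (circleTurn x) (circleTurn (F x)) :=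
    fun x => by rw [hlift]; exact (htan _).2
  have hfix : ∀ x, ψ^[3] (circleTurn x) = circleTurn x → ret F x = x := fun x hx =>
    ret_eq_of_iterate hlift hτ hx
  obtain ⟨x, hx⟩ := exists_ret_eq hF hτ
  have hx3 : ψ^[3] (circleTurn x) = circleTurn x := by rw [iterate_three_circleTurn hlift, hx]
  obtain ⟨hle, hge⟩ := kleinDelta_le_distToLine_iff hP hQ hR hPQ
  constructor
  · intro heq
    have hD := le_antisymm (hge.1 heq.le) (hle.1 heq.ge)
    have main := semistable_dynamics hF h1 hlift hfix
      (fun x => eventually_lt_ret_of_eq hF h1 hP hQ hR hv hD)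
      (fun x y => sameOrbit_of_eq h1 hP hQ hR hv hD)
    exact ⟨not_isConjugateToRotation _ hx3 (main _ _ _ hx3 rfl rfl).2.1, ⟨_, hx3⟩, main⟩
  · intro hlt
    have hD := lt_of_not_ge (mt hge.2 (not_le.2 hlt))
    have hAR := fun x => isAttracting_or_isRepelling_of_lt (x := x) hF h1 hP hQ hR hv hD
    have hSame := fun x y z => sameOrbit_of_lt (x := x) (y := y) (z := z) h1 hP hQ hR hv hD
    have main := hyperbolic_dynamics hF h1 hAR hSame hlift hfix
    have hex := hyperbolic_exists hF h1 hAR hSame hlift hx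
    refine ⟨?_, hex, main⟩
    obtain ⟨u, hu, hw⟩ := hex
    obtain ⟨⟨v, hv1, hv2, hv3⟩, h⟩ := main u _ _ hu rfl rfl hw
    exact not_isConjugateToRotation u hu (h v _ _ hv1 hv2 hv3 rfl rfl).2.1
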